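/- Let $a<b$ be real numbers and let $r,m\ge 1$ be integers. Let $L_1$ be the space of complex Lebesgue integrable functions on $[a,b]$ with norm $\|x\|_1=\int_a^b|x(t)|\,dt$, let $C^{(l)}$ be the space of $l$ times continuously differentiable functions $x:[a,b]\to\mathbb C$ with norm $\|x\|_{(l)}=\sum_{j=0}^{l}\max_{[a,b]}|x^{(j)}|$ (and $C=C^{(0)}$, $\|\cdot\|_C=\|\cdot\|_{(0)}$), and let $W_1^r$ be the space of all $x\in C^{(r-1)}$ with $x^{(r-1)}$ absolutely continuous on $[a,b]$, with norm $\|x\|_{r,1}=\sum_{j=0}^{r}\|x^{(j)}\|_1$. For vector-functions and for numerical vectors, the norm is the sum of the norms (moduli) of the components. Let $A_0,\dots,A_{r-1}\in(L_1)^{m\times m}$, put $$Ly:=y^{(r)}+\sum_{l=1}^{r}A_{r-l}\,y^{(r-l)},$$ and let $B:(C^{(r-1)})^m\to\mathbb C^{rm}$ be a continuous linear operator such that the boundary-value problem $$Ly(t)=f(t)\ \text{ for a.e. } t\in[a,b],\qquad By=q$$ has a unique solution $y\in(W_1^r)^m$ for all $f\in(L_1)^m$ and $q\in\mathbb C^{rm}$.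 For every natural number $k$, let $A_{0,k},\dots,A_{r-1,k}\in(L_1)^{m\times m}$, let $L_ky:=y^{(r)}+\sum_{l=1}^{r}A_{r-l,k}\,y^{(r-l)}$, and let $B_k$ be a multipoint operator $$B_ky=\sum_{j=1}^{p_k}\sum_{l=0}^{r-1}\beta_k^{j,l}\,y^{(l)}(t_{k,j}),\qquad \beta_k^{j,l}\in\mathbb C^{rm\times m},\quad t_{k,j}\in[a,b].$$ Assume that there is a natural number $\widetilde\varrho$ such that, for all $f\in(L_1)^m$ and $q\in\mathbb C^{rm}$, the problem $L_ky_k=f$ a.e. on $[a,b]$, $B_ky_k=q$ has a unique solution $y_k\in(W_1^r)^m$ whenever $k\ge\widetilde\varrho$, and $\|y_k-y\|_{r,1}\to0$ as $k\to\infty$, where $y$ is the solution of $Ly=f$, $By=q$. Let $f\in(L_1)^m$, $q\in\mathbb C^{rm}$, and let $y$ be the solution of $Ly=f$, $By=q$. For $k\ge\widetilde\varrho$ let $f_k\in(L_1)^m$, $q_k\in\mathbb C^{rm}$, and let $x_k\in(W_1^r)^m$ be the solution of $L_kx_k=f_k$ a.e. on $[a,b]$, $B_kx_k=q_k$. Put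 $F(t)=\int_a^tf(s)\,ds$ and $F_k(t)=\int_a^tf_k(s)\,ds$. Let $\widehat\varrho\ge\widetilde\varrho$ be a natural number such that $$\sigma:=\sup\bigl\{\|B_k:(C^{(r-1)})^m\to\mathbb C^{rm}\|:k\ge\widehat\varrho\bigr\}<\infty .$$ 1. Let $\varepsilon>0$ and suppose that $\|F_k-F\|_C<\varepsilon$ and $\|q_k-q\|<\varepsilon$ for all $k\ge\widehat\varrho$. Then there exist a number $\varkappa>0$ and a natural number $\varrho\ge\widehat\varrho$ such that $$\|x_k-y\|_{(r-1)}<\varkappa\,\sigma\,\varepsilon\qquad\text{for all } k\ge\varrho .$$ Here $\varkappa$ can be chosen depending only on $L$ and $B$ (thus independent of $\varepsilon$, $\sigma$, $\widehat\varrho$, $f$, $q$, and of the sequence of problems $L_kx_k=f_k$, $B_kx_k=q_k$), and $\varrho$ can be chosen independent of the $f_k$ and the $q_k$. 2. In particular, if $F_k\to F$ in $(C)^m$ and $q_k\to q$ in $\mathbb C^{rm}$ as $k\to\infty$, then $x_k\to y$ in $(C^{(r-1)})^m$ as $k\to\infty$. -/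

import Mathlib

open Set MeasureTheory Filter Topology

noncomputable section

namespace MultipointBVP

/-- The functions `x : [a,b] → ℂ` that are `l` times continuously differentiable on `[a,b]`
(one-sided derivatives at the end points), as a linear space. -/
def contDiffSubmodule {a b : ℝ} (hab : a < b) (l : ℕ) : Submodule ℂ (Icc a b → ℂ) where
  carrier := {x | ContDiffOn ℝ l (IccExtend hab.le x) (Icc a b)}
  add_mem' := fun hx hy => hx.add hy
  zero_mem' := (contDiff_const (c := (0 : ℂ))).contDiffOn
  smul_mem' := fun c _ hx => hx.const_smul c

/-- The space `C^{(l)}` of `l` times continuously differentiable complex functions on `[a,b]`. -/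
def CSpace {a b : ℝ} (hab : a < b) (l : ℕ) : Type :=
  contDiffSubmodule hab l

namespace CSpace

variable {a b : ℝ} {hab : a < b} {l : ℕ}

instance instAddCommGroup : AddCommGroup (CSpace hab l) :=
  inferInstanceAs (AddCommGroup (contDiffSubmodule hab l))

instance instModule : Module ℂ (CSpace hab l) :=
  inferInstanceAs (Module ℂ (contDiffSubmodule hab l))

/-- The function on `ℝ` that equals `x` on `[a,b]` and is constant on `(-∞,a]` and `[b,∞)`. -/
def extend (x : CSpace hab l) : ℝ → ℂ := IccExtend hab.le x.1

/-- The `j`-th derivative `x^{(j)}` of `x` relative to `[a,b]`; only its values on `[a,b]` matter. -/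
def der (x : CSpace hab l) (j : ℕ) : ℝ → ℂ := iteratedDerivWithin j x.extend (Icc a b)

theorem contDiffOn (x : CSpace hab l) : ContDiffOn ℝ l x.extend (Icc a b) := x.2

theorem continuousOn_der (x : CSpace hab l) {j : ℕ} (hj : j ≤ l) :
    ContinuousOn (x.der j) (Icc a b) :=
  x.contDiffOn.continuousOn_iteratedDerivWithin (by exact_mod_cast hj) (uniqueDiffOn_Icc hab)

theorem der_add (x y : CSpace hab l) {j : ℕ} (hj : j ≤ l) {t : ℝ} (ht : t ∈ Icc a b) :
    (x + y).der j t = x.der j t + y.der j t :=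
  iteratedDerivWithin_add ht (uniqueDiffOn_Icc hab)
    ((x.contDiffOn t ht).of_le (by exact_mod_cast hj))
    ((y.contDiffOn t ht).of_le (by exact_mod_cast hj))

theorem der_smul (c : ℂ) (x : CSpace hab l) {j : ℕ} (hj : j ≤ l) {t : ℝ} (ht : t ∈ Icc a b) :
    (c • x).der j t = c * x.der j t :=
  iteratedDerivWithin_const_smul ht (uniqueDiffOn_Icc hab) c
    ((x.contDiffOn t ht).of_le (by exact_mod_cast hj))

theorem der_zero (x : CSpace hab l) (t : Icc a b) : x.der 0 t = x.1 t := by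
  simp [der, extend]

/-- The linear map `x ↦ (x, x', …, x^{(l)})` into the product of `l + 1` copies of `C[a,b]`, where
the product carries the sum of the maximum norms. -/
def jet : CSpace hab l →ₗ[ℂ] PiLp 1 (fun _ : Fin (l + 1) => C(Icc a b, ℂ)) where
  toFun x := WithLp.toLp 1 fun j =>
    ⟨fun t => x.der j t, (x.continuousOn_der (Nat.lt_succ_iff.mp j.2)).domRestrict⟩
  map_add' x y := by
    ext j t
    exact der_add x y (Nat.lt_succ_iff.mp j.2) t.2
  map_smul' c x := by
    ext j t
    exact der_smul c x (Nat.lt_succ_iff.mp j.2) t.2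

theorem jet_injective : Function.Injective (jet : CSpace hab l →ₗ[ℂ] _) := by
  intro x y h
  apply Subtype.ext
  funext t
  have h1 := congrArg
    (fun u : PiLp 1 (fun _ : Fin (l + 1) => C(Icc a b, ℂ)) => u 0 t) h
  have h2 : x.der 0 t = y.der 0 t := h1
  rwa [der_zero, der_zero] at h2

/-- `C^{(l)}` carries the norm `‖x‖_{(l)} = ∑_{j ≤ l} ‖x^{(j)}‖_C`, see `norm_eq`. -/
instance instNormedAddCommGroup : NormedAddCommGroup (CSpace hab l) :=
  NormedAddCommGroup.induced (CSpace hab l) _ (jet : CSpace hab l →ₗ[ℂ] _) jet_injective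

instance instNormedSpace : NormedSpace ℂ (CSpace hab l) :=
  NormedSpace.induced ℂ (CSpace hab l) _ (jet : CSpace hab l →ₗ[ℂ] _)

theorem norm_eq (x : CSpace hab l) :
    ‖x‖ = ∑ j ∈ Finset.range (l + 1), ⨆ t : Icc a b, ‖x.der j t‖ := by
  have h : ‖x‖ = ‖jet x‖ := rfl
  rw [h, PiLp.norm_eq_of_L1, ← Fin.sum_univ_eq_sum_range (fun j => ⨆ t : Icc a b, ‖x.der j t‖)]
  refine Finset.sum_congr rfl fun j _ => ?_
  rw [ContinuousMap.norm_eq_iSup_norm]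
  rfl

/-- Membership in the Sobolev space `W_1^r` of an element of `C^{(r-1)}` (`r ≥ 1`):
the derivative of order `r - 1` is absolutely continuous on `[a,b]`. -/
def MemSobolev {r : ℕ} (x : CSpace hab (r - 1)) : Prop :=
  AbsolutelyContinuousOnInterval (x.der (r - 1)) a b

end CSpace

/-- The space `(C^{(l)})^m`, with the sum of the norms of the components. -/
abbrev CVec {a b : ℝ} (hab : a < b) (l m : ℕ) : Type :=
  PiLp 1 (fun _ : Fin m => CSpace hab l)

/-- The space `ℂ^n` with the norm `∑ |q_i|`. -/
abbrev CNum (n : ℕ) : Type := PiLp 1 (fun _ : Fin n => ℂ)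

/-- The space `L_1` of complex (classes of) Lebesgue integrable functions on `[a,b]`. -/
abbrev L1Space (a b : ℝ) : Type := Lp ℂ 1 (volume.restrict (Icc a b))

/-- The space `(L_1)^m`. -/
abbrev L1Vec (a b : ℝ) (m : ℕ) : Type := PiLp 1 (fun _ : Fin m => L1Space a b)

/-- The coefficients `A_0, …, A_{r-1} ∈ (L_1)^{m × m}` of a differential expression. -/
abbrev Coeffs (a b : ℝ) (r m : ℕ) : Type := Fin r → Matrix (Fin m) (Fin m) (L1Space a b)

section

variable {a b : ℝ} {hab : a < b} {r m : ℕ}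

/-- The `i`-th component of `Ly(t) = y^{(r)}(t) + ∑_{j=0}^{r-1} A_j(t) y^{(j)}(t)`. -/
def diffExpr (A : Coeffs a b r m) (y : CVec hab (r - 1) m) (i : Fin m) (t : ℝ) : ℂ :=
  (y i).der r t + ∑ j : Fin r, ∑ s : Fin m, A j i s t * (y s).der j t

/-- `y` is a solution of class `(W_1^r)^m` of the boundary-value problem
`Ly = f` a.e. on `[a,b]`, `By = q`. -/
structure IsSolution (A : Coeffs a b r m) (B : CVec hab (r - 1) m →L[ℂ] CNum (r * m))
    (f : L1Vec a b m) (q : CNum (r * m)) (y : CVec hab (r - 1) m) : Prop where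
  memSobolev : ∀ i, (y i).MemSobolev
  equation : ∀ i, ∀ᵐ t ∂(volume.restrict (Icc a b)), diffExpr A y i t = f i t
  boundary : B y = q

/-- The boundary-value problem has exactly one solution for all right-hand sides. -/
def UniquelySolvable (A : Coeffs a b r m)
    (B : CVec hab (r - 1) m →L[ℂ] CNum (r * m)) : Prop :=
  ∀ (f : L1Vec a b m) (q : CNum (r * m)), ∃! y : CVec hab (r - 1) m, IsSolution A B f q y

/-- `B` is a multipoint operator
`By = ∑_{j=1}^{p} ∑_{l=0}^{r-1} β^{j,l} y^{(l)}(t_j)` with points `t_j ∈ [a,b]`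
and numerical matrices `β^{j,l}` of size `rm × m`. -/
def IsMultipoint (B : CVec hab (r - 1) m →L[ℂ] CNum (r * m)) : Prop :=
  ∃ (p : ℕ) (t : Fin p → Icc a b) (β : Fin p → Fin r → Matrix (Fin (r * m)) (Fin m) ℂ),
    ∀ (y : CVec hab (r - 1) m) (i : Fin (r * m)),
      B y i = ∑ j : Fin p, ∑ l : Fin r, ∑ s : Fin m, β j l i s * (y s).der l (t j)

/-- The Sobolev norm `‖y‖_{r,1} = ∑_i ∑_{j=0}^{r} ∫_a^b |y_i^{(j)}(t)| dt`
(meaningful for `y` in `(W_1^r)^m`). -/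
def sobolevNorm (y : CVec hab (r - 1) m) : ℝ :=
  ∑ i : Fin m, ∑ j ∈ Finset.range (r + 1), ∫ t in a..b, ‖(y i).der j t‖

/-- The multipoint problems with coefficients `A_k` and boundary operators `B_k` are uniquely
solvable for `k ≥ ϱ₀`, and for all right-hand sides `f`, `q` (the same for all `k`) their solutions
`y_k` converge in `(W_1^r)^m` to the solution `y` of the problem given by `A` and `B`. -/
structure IsApproximating (A : Coeffs a b r m) (B : CVec hab (r - 1) m →L[ℂ] CNum (r * m))
    (Ak : ℕ → Coeffs a b r m) (Bk : ℕ → CVec hab (r - 1) m →L[ℂ] CNum (r * m))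
    (ϱ₀ : ℕ) : Prop where
  multipoint : ∀ k, IsMultipoint (Bk k)
  uniquelySolvable : ∀ k, ϱ₀ ≤ k → UniquelySolvable (Ak k) (Bk k)
  tendsto : ∀ (f : L1Vec a b m) (q : CNum (r * m)) (y : CVec hab (r - 1) m)
    (yk : ℕ → CVec hab (r - 1) m), IsSolution A B f q y →
    (∀ k, ϱ₀ ≤ k → IsSolution (Ak k) (Bk k) f q (yk k)) →
    Tendsto (fun k => sobolevNorm (yk k - y)) atTop (𝓝 0)

end

/-- The antiderivative `F(t) = ∫_a^t f` on `[a,b]` of `f ∈ (L_1)^m`, as an element of `(C)^m`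
with the norm `‖F‖_C = ∑_i max_t |F_i(t)|`. -/
def antideriv {a b : ℝ} (hab : a < b) {m : ℕ} (f : L1Vec a b m) :
    PiLp 1 (fun _ : Fin m => C(Icc a b, ℂ)) :=
  WithLp.toLp 1 fun i =>
    ⟨fun t => ∫ s in a..t, f i s, by
      have h : IntegrableOn (f i) (uIcc a b) := by
        rw [uIcc_of_le hab.le]
        exact L1.integrable_coeFn (f i)
      have h2 := intervalIntegral.continuousOn_primitive_interval h
      rw [uIcc_of_le hab.le] at h2
      exact h2.domRestrict⟩

end MultipointBVP

end

/-! Compare `x_k` with the solution `y_k` of `L_k y_k = f`, `B_k y_k = q`. By assumption `y_k → y`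
in `W_1^r`, hence in `C^{(r-1)}`, so the difference `z = x_k - y_k` is what matters; it solves `L_k
z = f_k - f`, `B_k z = q_k - q`. The core is the estimate `‖z‖ ≤ C σ ε` with `C` depending only on
`L` and `B` (`exists_norm_le_of_close`).

No bound on the coefficients of `L_k` is given; they are controlled through solutions. The `rm`
solutions of `L_k Y = 0`, `B_k Y = e_p` converge to those of the limit problem. The equation says
that each row of coefficients, multiplied by the Wronski matrix, is minus the vector of `r`-th
derivatives. The limit Wronski matrix is uniformly invertible on `[a,b]`, so nearby ones are bounded
below and the `L_1` norms of the coefficients stay bounded (`exists_integral_coeffNorm_le`).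

Gronwall's inequality now bounds the solution `w` of `L_k w = f_k - f` with zero Cauchy data at `a`.
Since the equation is integrated before moduli are taken, only `F_k - F` enters, not the `L_1` norm
of `f_k - f`. The rest `z - w` is a combination of fundamental solutions whose coefficients are the
components of `B_k (z - w)`, which costs one factor `σ`. Terms without `σ` are absorbed, because
`‖B_k Y‖ = 1` for a bounded `Y` keeps `σ` away from zero. -/

/-! ### Absolutely continuous complex-valued functions. -/

theorem LipschitzOnWith.comp_absolutelyContinuousOnInterval {X Y : Type*} [PseudoMetricSpace X]
    [PseudoMetricSpace Y] {g : X → Y} {f : ℝ → X} {K : NNReal} {s : Set X} {a b : ℝ}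
    (hg : LipschitzOnWith K g s) (hf : AbsolutelyContinuousOnInterval f a b)
    (hs : MapsTo f (uIcc a b) s) : AbsolutelyContinuousOnInterval (fun t => g (f t)) a b := by
  rw [absolutelyContinuousOnInterval_iff] at hf ⊢
  intro ε hε
  obtain ⟨δ, hδ, h⟩ := hf (ε / (K + 1)) (by positivity)
  refine ⟨δ, hδ, fun E hE hlt => ?_⟩
  have h1 := h E hE hlt
  rw [lt_div_iff₀ (by positivity)] at h1
  refine lt_of_le_of_lt ?_ h1
  rw [Finset.sum_mul]
  refine Finset.sum_le_sum fun i hi => ?_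
  have hmem := hE.1 i hi
  calc dist (g (f (E.2 i).1)) (g (f (E.2 i).2))
      ≤ K * dist (f (E.2 i).1) (f (E.2 i).2) := hg.dist_le_mul _ (hs hmem.1) _ (hs hmem.2)
    _ ≤ dist (f (E.2 i).1) (f (E.2 i).2) * (K + 1) := by
      nlinarith [dist_nonneg (x := f (E.2 i).1) (y := f (E.2 i).2)]

theorem IntervalIntegrable.complexOfReal {f : ℝ → ℝ} {a b : ℝ} {μ : Measure ℝ}
    (hf : IntervalIntegrable f μ a b) : IntervalIntegrable (fun t => (f t : ℂ)) μ a b :=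
  ⟨Integrable.ofReal hf.1, Integrable.ofReal hf.2⟩

namespace AbsolutelyContinuousOnInterval

variable {f : ℝ → ℂ} {a b : ℝ}

theorem complex_re (hf : AbsolutelyContinuousOnInterval f a b) :
    AbsolutelyContinuousOnInterval (fun t => (f t).re) a b :=
  (Complex.reCLM.lipschitz.lipschitzOnWith (s := univ)).comp_absolutelyContinuousOnInterval hf
    (mapsTo_univ _ _)

theorem complex_im (hf : AbsolutelyContinuousOnInterval f a b) :
    AbsolutelyContinuousOnInterval (fun t => (f t).im) a b :=
  (Complex.imCLM.lipschitz.lipschitzOnWith (s := univ)).comp_absolutelyContinuousOnInterval hf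
    (mapsTo_univ _ _)

/-- The real theory applies to both components. Writing the derivative through real derivatives
reduces its integrability and its integral to the real case. -/
theorem complex_ae_hasDerivAt (hf : AbsolutelyContinuousOnInterval f a b) :
    ∀ᵐ t, t ∈ uIcc a b → HasDerivAt f
      (((deriv (fun t => (f t).re) t : ℝ) : ℂ) + ((deriv (fun t => (f t).im) t : ℝ) : ℂ) * Complex.I) t := by
  filter_upwards [hf.complex_re.ae_differentiableAt, hf.complex_im.ae_differentiableAt]
    with t h1 h2 ht
  have h := ((h1 ht).hasDerivAt.ofReal_comp).add (((h2 ht).hasDerivAt.ofReal_comp).mul_const Complex.I)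
  refine h.congr_of_eventuallyEq (Eventually.of_forall fun s => ?_)
  simp [Complex.re_add_im]

theorem complex_ae_differentiableAt (hf : AbsolutelyContinuousOnInterval f a b) :
    ∀ᵐ t, t ∈ uIcc a b → DifferentiableAt ℝ f t := by
  filter_upwards [hf.complex_ae_hasDerivAt] with t h ht using (h ht).differentiableAt

theorem complex_intervalIntegrable_deriv (hf : AbsolutelyContinuousOnInterval f a b) :
    IntervalIntegrable (deriv f) volume a b := by
  have h : IntervalIntegrable (fun t => ((deriv (fun t => (f t).re) t : ℝ) : ℂ)
      + ((deriv (fun t => (f t).im) t : ℝ) : ℂ) * Complex.I) volume a b :=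
    (hf.complex_re.intervalIntegrable_deriv.complexOfReal).add
      (hf.complex_im.intervalIntegrable_deriv.complexOfReal.mul_const _)
  refine h.congr_ae ?_
  refine (ae_restrict_iff' measurableSet_uIoc).2 ?_
  filter_upwards [hf.complex_ae_hasDerivAt] with t h ht
  exact (h (uIoc_subset_uIcc ht)).deriv.symm

theorem complex_integral_deriv_eq_sub (hf : AbsolutelyContinuousOnInterval f a b) :
    ∫ t in a..b, deriv f t = f b - f a := by
  have h : ∫ t in a..b, deriv f t = ∫ t in a..b, (((deriv (fun t => (f t).re) t : ℝ) : ℂ)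
      + ((deriv (fun t => (f t).im) t : ℝ) : ℂ) * Complex.I) := by
    refine intervalIntegral.integral_congr_ae ?_
    filter_upwards [hf.complex_ae_hasDerivAt] with t h ht
    exact (h (uIoc_subset_uIcc ht)).deriv
  rw [h, intervalIntegral.integral_add hf.complex_re.intervalIntegrable_deriv.complexOfReal
    (hf.complex_im.intervalIntegrable_deriv.complexOfReal.mul_const _),
    intervalIntegral.integral_mul_const, intervalIntegral.integral_ofReal,
    intervalIntegral.integral_ofReal, hf.complex_re.integral_deriv_eq_sub,
    hf.complex_im.integral_deriv_eq_sub]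
  apply Complex.ext <;> simp

end AbsolutelyContinuousOnInterval

/-! ### Gronwall's inequality. -/

/-- As `β` is merely integrable, its primitive is known to be differentiable only almost everywhere.
The fundamental theorem still applies: `exp` is Lipschitz on the bounded range of the primitive, so
the composition is absolutely continuous. -/
theorem IntervalIntegrable.integral_mul_exp_primitive {β : ℝ → ℝ} {c d κ : ℝ}
    (hβ : IntervalIntegrable β volume c d) :
    κ * ∫ s in c..d, β s * Real.exp (κ * ∫ u in c..s, β u)
      = Real.exp (κ * ∫ u in c..d, β u) - 1 := by
  set P : ℝ → ℝ := fun s => κ * ∫ u in c..s, β u with hP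
  have hPac : AbsolutelyContinuousOnInterval P c d :=
    (hβ.absolutelyContinuousOnInterval_intervalIntegral (c := c) (by simp)).const_mul κ
  obtain ⟨C, hC⟩ := hPac.exists_bound
  obtain ⟨K, hK⟩ : ∃ K, LipschitzOnWith K Real.exp (Icc (-C) C) :=
    (Real.contDiff_exp (n := 1)).contDiffOn.exists_lipschitzOnWith one_ne_zero (convex_Icc _ _)
      isCompact_Icc
  have hE : AbsolutelyContinuousOnInterval (fun s => Real.exp (P s)) c d :=
    hK.comp_absolutelyContinuousOnInterval hPac fun s hs => abs_le.1 (hC s hs)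
  have h1 := hE.integral_deriv_eq_sub
  have h2 : ∫ s in c..d, deriv (fun s => Real.exp (P s)) s
      = ∫ s in c..d, κ * (β s * Real.exp (P s)) := by
    refine intervalIntegral.integral_congr_ae ?_
    filter_upwards [hβ.ae_hasDerivAt_integral] with t h ht
    have h3 := (((h (uIoc_subset_uIcc ht) c (by simp)).const_mul κ).exp).deriv
    rw [h3]; ring
  rw [h2, intervalIntegral.integral_const_mul] at h1
  rw [h1]
  simp [hP]

/-- Gronwall's inequality with an integrable kernel, on both sides of the point `c`. -/
theorem le_mul_exp_of_le_add_abs_integral {β φ : ℝ → ℝ} {a b c K : ℝ}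
    (hβ : IntegrableOn β (Icc a b)) (hβ0 : ∀ t, 0 ≤ β t)
    (hφ : ContinuousOn φ (Icc a b)) (hφ0 : ∀ t, 0 ≤ φ t) (hc : c ∈ Icc a b)
    (h : ∀ t ∈ Icc a b, φ t ≤ K + |∫ s in c..t, β s * φ s|) :
    ∀ t ∈ Icc a b, φ t ≤ 2 * K * Real.exp (2 * ∫ s in a..b, β s) := by
  have hab : a ≤ b := hc.1.trans hc.2
  have hK : 0 ≤ K := by
    have := h c hc
    simp only [intervalIntegral.integral_same, abs_zero, add_zero] at this
    exact (hφ0 c).trans this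
  have hii : ∀ s ∈ Icc a b, ∀ t ∈ Icc a b, IntervalIntegrable β volume s t := fun s hs t ht =>
    (hβ.mono_set (uIcc_subset_Icc hs ht)).intervalIntegrable
  set A : ℝ → ℝ := fun t => ∫ s in c..t, β s with hA
  have hAcont : ContinuousOn A (Icc a b) := by
    have := (hii a (left_mem_Icc.2 hab) b (right_mem_Icc.2 hab)).absolutelyContinuousOnInterval_intervalIntegral
      (c := c) (by rwa [uIcc_of_le hab])
    simpa [uIcc_of_le hab] using this.continuousOn
  -- With the exponent 2 in the weight, the integral term is at most half of the weighted maximum,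
  -- so it can be absorbed at a point `t₀` where the maximum is attained.
  set v : ℝ → ℝ := fun t => φ t * Real.exp (-(2 * |A t|)) with hv
  have hvcont : ContinuousOn v (Icc a b) := by fun_prop
  obtain ⟨t₀, ht₀, hmax⟩ := isCompact_Icc.exists_isMaxOn ⟨c, hc⟩ hvcont
  set S := v t₀ with hS
  have hS0 : 0 ≤ S := mul_nonneg (hφ0 _) (Real.exp_pos _).le
  have hφle : ∀ t ∈ Icc a b, φ t ≤ S * Real.exp (2 * |A t|) := by
    intro t ht
    have h1 : v t ≤ S := hmax ht
    have h2 : φ t = v t * Real.exp (2 * |A t|) := by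
      simp only [hv]; rw [mul_assoc, ← Real.exp_add]; simp
    rw [h2]; gcongr
  have key : ∀ t ∈ Icc a b, |∫ s in c..t, β s * φ s| ≤ S * (Real.exp (2 * |A t|) / 2) := by
    intro t ht
    have hint : IntervalIntegrable (fun s => β s * φ s) volume c t :=
      (hii c hc t ht).mul_continuousOn (hφ.mono (uIcc_subset_Icc hc ht))
    have hA' : ContinuousOn A (uIcc c t) := hAcont.mono (uIcc_subset_Icc hc ht)
    rcases le_total c t with hct | hct
    · have hnn : ∀ s ∈ Icc c t, 0 ≤ A s := fun s hs =>
        intervalIntegral.integral_nonneg hs.1 fun _ _ => hβ0 _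
      have e := (hii c hc t ht).integral_mul_exp_primitive (κ := 2)
      rw [abs_of_nonneg (intervalIntegral.integral_nonneg hct fun s _ =>
        mul_nonneg (hβ0 s) (hφ0 s)), abs_of_nonneg (hnn t (right_mem_Icc.2 hct))]
      have : ∫ s in c..t, β s * φ s ≤ ∫ s in c..t, S * (β s * Real.exp (2 * A s)) := by
        refine intervalIntegral.integral_mono_on hct hint
          (((hii c hc t ht).mul_continuousOn (by fun_prop)).const_mul S) fun s hs => ?_
        have := hφle s ⟨hc.1.trans hs.1, hs.2.trans ht.2⟩
        rw [abs_of_nonneg (hnn s hs)] at this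
        nlinarith [hβ0 s]
      rw [intervalIntegral.integral_const_mul] at this
      refine this.trans (mul_le_mul_of_nonneg_left ?_ hS0)
      linarith
    · have hnn : ∀ s ∈ Icc t c, A s ≤ 0 := fun s hs => by
        simp only [hA]
        rw [intervalIntegral.integral_symm]
        exact neg_nonpos.2 (intervalIntegral.integral_nonneg hs.2 fun _ _ => hβ0 _)
      -- To the left of `c` the primitive is nonpositive, so `|A| = -A` and the exponent changes
      -- sign.
      have e := (hii c hc t ht).integral_mul_exp_primitive (κ := -2)
      rw [intervalIntegral.integral_symm, abs_neg, abs_of_nonneg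
        (intervalIntegral.integral_nonneg hct fun s _ => mul_nonneg (hβ0 s) (hφ0 s)),
        abs_of_nonpos (hnn t (left_mem_Icc.2 hct))]
      have : ∫ s in t..c, β s * φ s ≤ ∫ s in t..c, S * (β s * Real.exp (-2 * A s)) := by
        refine intervalIntegral.integral_mono_on hct hint.symm
          ((((hii c hc t ht).mul_continuousOn (by fun_prop)).const_mul S).symm) fun s hs => ?_
        have := hφle s ⟨ht.1.trans hs.1, hs.2.trans hc.2⟩
        rw [abs_of_nonpos (hnn s hs)] at this
        rw [show -2 * A s = 2 * -A s by ring]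
        nlinarith [hβ0 s]
      rw [intervalIntegral.integral_const_mul] at this
      refine this.trans (mul_le_mul_of_nonneg_left ?_ hS0)
      rw [intervalIntegral.integral_symm] at e
      rw [show 2 * -A t = -2 * A t by ring]
      linarith
  have hSK : S ≤ 2 * K := by
    have h1 := (h t₀ ht₀).trans (add_le_add_right (key t₀ ht₀) K)
    have h2 : φ t₀ = S * Real.exp (2 * |A t₀|) := by
      simp only [hS, hv]; rw [mul_assoc, ← Real.exp_add]; simp
    have h3 : 1 ≤ Real.exp (2 * |A t₀|) := Real.one_le_exp (by positivity)
    nlinarith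
  intro t ht
  refine (hφle t ht).trans ?_
  have hle : |A t| ≤ ∫ s in a..b, β s := by
    rw [← abs_of_nonneg (intervalIntegral.integral_nonneg hab fun s _ => hβ0 s)]
    refine intervalIntegral.abs_integral_mono_interval ?_ (Eventually.of_forall hβ0)
      (hii a (left_mem_Icc.2 hab) b (right_mem_Icc.2 hab))
    exact uIoc_subset_uIoc_of_uIcc_subset_uIcc (by
      rw [uIcc_of_le hab]; exact uIcc_subset_Icc hc ht)
  gcongr

/-! ### Derivatives and norms of functions in `W_1^r`. -/

theorem AbsolutelyContinuousOnInterval.congr {X : Type*} [PseudoMetricSpace X] {f g : ℝ → X}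
    {a b : ℝ} (hf : AbsolutelyContinuousOnInterval f a b) (h : EqOn f g (uIcc a b)) :
    AbsolutelyContinuousOnInterval g a b := by
  rw [absolutelyContinuousOnInterval_iff] at hf ⊢
  intro ε hε
  obtain ⟨δ, hδ, h1⟩ := hf ε hε
  refine ⟨δ, hδ, fun E hE hlt => ?_⟩
  convert h1 E hE hlt using 1
  refine Finset.sum_congr rfl fun i hi => ?_
  rw [h (hE.1 i hi).1, h (hE.1 i hi).2]

noncomputable section

namespace MultipointBVP

namespace CSpace

variable {a b : ℝ} {hab : a < b} {r : ℕ} {x y : CSpace hab (r - 1)}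

theorem der_succ (x : CSpace hab (r - 1)) (j : ℕ) :
    x.der (j + 1) = derivWithin (x.der j) (Icc a b) := iteratedDerivWithin_succ

/-- Sobolev membership is needed only for `j = r - 1`; derivatives of lower order are continuously
differentiable. -/
theorem absolutelyContinuous_der (hx : x.MemSobolev) {j : ℕ} (hj : j < r) :
    AbsolutelyContinuousOnInterval (x.der j) a b := by
  rcases (Nat.le_sub_one_of_lt hj).eq_or_lt with h | h
  · rw [h]; exact hx
  · refine ContDiffOn.absolutelyContinuousOnInterval ?_
    rw [uIcc_of_le hab.le]
    have hu := uniqueDiffOn_Icc hab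
    refine (contDiffOn_one_iff_derivWithin hu).2 ⟨?_, ?_⟩
    · exact x.contDiffOn.differentiableOn_iteratedDerivWithin (by exact_mod_cast h) hu
    · rw [← der_succ]
      exact x.continuousOn_der (by omega)

theorem der_succ_eq_deriv (x : CSpace hab (r - 1)) (j : ℕ) {t : ℝ} (ht : t ∈ Ioo a b) :
    x.der (j + 1) t = deriv (x.der j) t := by
  rw [der_succ, derivWithin_of_mem_nhds (Icc_mem_nhds ht.1 ht.2)]

theorem ae_mem_Ioo : ∀ᵐ t : ℝ, t ∈ Icc a b → t ∈ Ioo a b := by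
  have h : ∀ᵐ t : ℝ, t ∉ ({a, b} : Set ℝ) :=
    measure_eq_zero_iff_ae_notMem.1 ((toFinite ({a, b} : Set ℝ)).measure_zero volume)
  filter_upwards [h] with t h1 h2
  simp only [mem_insert_iff, mem_singleton_iff, not_or] at h1
  exact ⟨lt_of_le_of_ne h2.1 (Ne.symm h1.1), lt_of_le_of_ne h2.2 h1.2⟩

theorem ae_der_succ_eq_deriv (x : CSpace hab (r - 1)) (j : ℕ) :
    ∀ᵐ t : ℝ, t ∈ Icc a b → x.der (j + 1) t = deriv (x.der j) t := by
  filter_upwards [ae_mem_Ioo (a := a) (b := b)] with t h1 h2 using x.der_succ_eq_deriv j (h1 h2)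

theorem intervalIntegrable_der_succ (hx : x.MemSobolev) {j : ℕ} (hj : j < r) {s t : ℝ}
    (hs : s ∈ Icc a b) (ht : t ∈ Icc a b) :
    IntervalIntegrable (x.der (j + 1)) volume s t := by
  have hsub : uIcc s t ⊆ Icc a b := uIcc_subset_Icc hs ht
  have h := ((absolutelyContinuous_der hx hj).mono
    (hsub.trans_eq (uIcc_of_le hab.le).symm)).complex_intervalIntegrable_deriv
  refine h.congr_ae ((ae_restrict_iff' measurableSet_uIoc).2 ?_)
  filter_upwards [x.ae_der_succ_eq_deriv j] with u h1 h2
  exact (h1 (hsub (uIoc_subset_uIcc h2))).symm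

theorem integral_der_succ (hx : x.MemSobolev) {j : ℕ} (hj : j < r) {s t : ℝ}
    (hs : s ∈ Icc a b) (ht : t ∈ Icc a b) :
    ∫ u in s..t, x.der (j + 1) u = x.der j t - x.der j s := by
  have hsub : uIcc s t ⊆ Icc a b := uIcc_subset_Icc hs ht
  rw [← ((absolutelyContinuous_der hx hj).mono
    (hsub.trans_eq (uIcc_of_le hab.le).symm)).complex_integral_deriv_eq_sub]
  refine intervalIntegral.integral_congr_ae ?_
  filter_upwards [x.ae_der_succ_eq_deriv j] with u h1 h2
  exact h1 (hsub (uIoc_subset_uIcc h2))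

theorem MemSobolev.add (hx : x.MemSobolev) (hy : y.MemSobolev) : (x + y).MemSobolev :=
  (AbsolutelyContinuousOnInterval.add hx hy).congr fun t ht =>
    (der_add x y le_rfl (by rwa [uIcc_of_le hab.le] at ht)).symm

theorem MemSobolev.smul (c : ℂ) (hx : x.MemSobolev) : (c • x).MemSobolev :=
  (AbsolutelyContinuousOnInterval.const_smul c hx).congr fun t ht =>
    (der_smul c x le_rfl (by rwa [uIcc_of_le hab.le] at ht)).symm

theorem MemSobolev.sub (hx : x.MemSobolev) (hy : y.MemSobolev) : (x - y).MemSobolev := by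
  have h := hx.add (hy.smul (-1))
  rwa [neg_smul, one_smul, ← sub_eq_add_neg] at h

/-- The point is the order `j = r`, beyond the reach of `der_add`: there the derivative of order `r
- 1` is differentiable only almost everywhere. -/
theorem ae_der_add (hx : x.MemSobolev) (hy : y.MemSobolev) {j : ℕ} (hj : j ≤ r) :
    ∀ᵐ t, t ∈ Icc a b → (x + y).der j t = x.der j t + y.der j t := by
  rcases j with _ | j
  · exact Eventually.of_forall fun t ht => der_add x y (Nat.zero_le _) ht
  filter_upwards [ae_mem_Ioo (a := a) (b := b),
    (absolutelyContinuous_der hx hj).complex_ae_differentiableAt,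
    (absolutelyContinuous_der hy hj).complex_ae_differentiableAt] with t h0 h1 h2 ht
  have ht' : t ∈ uIcc a b := by rwa [uIcc_of_le hab.le]
  rw [der_succ_eq_deriv _ _ (h0 ht), der_succ_eq_deriv _ _ (h0 ht), der_succ_eq_deriv _ _ (h0 ht),
    ← deriv_add (h1 ht') (h2 ht')]
  refine Filter.EventuallyEq.deriv_eq ?_
  filter_upwards [Icc_mem_nhds (h0 ht).1 (h0 ht).2] with s hs
  exact der_add x y (by omega) hs

theorem ae_der_smul (c : ℂ) (hx : x.MemSobolev) {j : ℕ} (hj : j ≤ r) :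
    ∀ᵐ t, t ∈ Icc a b → (c • x).der j t = c * x.der j t := by
  rcases j with _ | j
  · exact Eventually.of_forall fun t ht => der_smul c x (Nat.zero_le _) ht
  filter_upwards [ae_mem_Ioo (a := a) (b := b),
    (absolutelyContinuous_der hx hj).complex_ae_differentiableAt] with t h0 h1 ht
  have ht' : t ∈ uIcc a b := by rwa [uIcc_of_le hab.le]
  rw [der_succ_eq_deriv _ _ (h0 ht), der_succ_eq_deriv _ _ (h0 ht)]
  have h2 : deriv (fun s => c * x.der j s) t = c * deriv (x.der j) t :=
    deriv_const_mul c (h1 ht')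
  rw [← h2]
  refine Filter.EventuallyEq.deriv_eq ?_
  filter_upwards [Icc_mem_nhds (h0 ht).1 (h0 ht).2] with s hs
  exact der_smul c x (by omega) hs

theorem norm_der_le_norm {l : ℕ} (x : CSpace hab l) {j : ℕ} (hj : j ≤ l) {t : ℝ}
    (ht : t ∈ Icc a b) : ‖x.der j t‖ ≤ ‖x‖ := by
  rw [norm_eq]
  have hcont : ∀ j ≤ l, BddAbove (range fun t : Icc a b => ‖x.der j t‖) := fun j hj => by
    have h := (isCompact_Icc.image_of_continuousOn (x.continuousOn_der hj).norm).bddAbove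
    refine h.mono ?_
    rintro _ ⟨t, rfl⟩
    exact ⟨t, t.2, rfl⟩
  refine (le_ciSup (hcont j hj) ⟨t, ht⟩).trans ?_
  exact Finset.single_le_sum (f := fun j => ⨆ t : Icc a b, ‖x.der j t‖)
    (fun i _ => Real.iSup_nonneg fun _ => norm_nonneg _) (Finset.mem_range.2 (by omega))

/-- Values at `s` and `t` differ by at most the integral of `|x^{(j+1)}|`; average over `s` in
`[a,b]`. This yields the embedding of `W_1^r` into `C^{(r-1)}`. -/
theorem norm_der_le_integral (hx : x.MemSobolev) {j : ℕ} (hj : j < r) {t : ℝ}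
    (ht : t ∈ Icc a b) :
    ‖x.der j t‖ ≤ (b - a)⁻¹ * (∫ s in a..b, ‖x.der j s‖) + ∫ s in a..b, ‖x.der (j + 1) s‖ := by
  have ha := left_mem_Icc.2 hab.le
  have hb := right_mem_Icc.2 hab.le
  have hint := intervalIntegrable_der_succ hx hj ha hb
  set D := ∫ s in a..b, ‖x.der (j + 1) s‖ with hD
  have hpt : ∀ s ∈ Icc a b, ‖x.der j t‖ - D ≤ ‖x.der j s‖ := by
    intro s hs
    have h1 : x.der j t = x.der j s + ∫ u in s..t, x.der (j + 1) u := by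
      rw [integral_der_succ hx hj hs ht]; ring
    have h2 : ‖∫ u in s..t, x.der (j + 1) u‖ ≤ D := by
      refine (intervalIntegral.norm_integral_le_abs_integral_norm).trans ?_
      rw [hD, ← abs_of_nonneg (intervalIntegral.integral_nonneg hab.le fun s _ =>
        norm_nonneg (x.der (j + 1) s))]
      exact intervalIntegral.abs_integral_mono_interval
        (uIoc_subset_uIoc_of_uIcc_subset_uIcc (by
          rw [uIcc_of_le hab.le]; exact uIcc_subset_Icc hs ht))
        (Eventually.of_forall fun _ => norm_nonneg _) hint.norm
    have h3 := norm_add_le (x.der j s) (∫ u in s..t, x.der (j + 1) u)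
    rw [← h1] at h3
    linarith
  have hcont : ContinuousOn (fun s => ‖x.der j s‖) (uIcc a b) := by
    rw [uIcc_of_le hab.le]; exact (x.continuousOn_der (by omega)).norm
  have h4 := intervalIntegral.integral_mono_on hab.le (intervalIntegrable_const (μ := volume))
    hcont.intervalIntegrable hpt
  rw [intervalIntegral.integral_const, smul_eq_mul] at h4
  have h5 : 0 < b - a := sub_pos.2 hab
  have h6 : ‖x.der j t‖ - D ≤ (b - a)⁻¹ * ∫ s in a..b, ‖x.der j s‖ := by
    rw [inv_mul_eq_div, le_div_iff₀ h5]; linarith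
  linarith

end CSpace

section

variable {a b : ℝ} {hab : a < b} {r m : ℕ}

theorem norm_der_le_norm (y : CVec hab (r - 1) m) (i : Fin m) {j : ℕ} (hj : j < r) {t : ℝ}
    (ht : t ∈ Icc a b) : ‖(y i).der j t‖ ≤ ‖y‖ := by
  refine ((y i).norm_der_le_norm (by omega) ht).trans ?_
  rw [PiLp.norm_eq_of_L1]
  exact Finset.single_le_sum (f := fun i => ‖y i‖) (fun i _ => norm_nonneg _) (Finset.mem_univ i)

theorem norm_le_of_norm_der_le (hr : 1 ≤ r) {y : CVec hab (r - 1) m} {C : ℝ}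
    (h : ∀ i, ∀ j < r, ∀ t ∈ Icc a b, ‖(y i).der j t‖ ≤ C) : ‖y‖ ≤ m * (r * C) := by
  rw [PiLp.norm_eq_of_L1]
  have h1 : ∀ i, ‖y i‖ ≤ r * C := fun i => by
    rw [CSpace.norm_eq, Nat.sub_add_cancel hr]
    have : Nonempty (Icc a b) := ⟨⟨a, left_mem_Icc.2 hab.le⟩⟩
    refine (Finset.sum_le_sum (g := fun _ => C) fun j hj => ?_).trans (by simp)
    exact ciSup_le fun t => h i j (Finset.mem_range.1 hj) t t.2
  calc _ ≤ ∑ i : Fin m, (r * C : ℝ) := Finset.sum_le_sum fun i _ => h1 i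
    _ = m * (r * C) := by simp

theorem norm_le_sobolevNorm (hr : 1 ≤ r) {y : CVec hab (r - 1) m} (hy : ∀ i, (y i).MemSobolev) :
    ‖y‖ ≤ m * (r * (((b - a)⁻¹ + 1) * sobolevNorm y)) := by
  have h5 : 0 < b - a := sub_pos.2 hab
  have hnn : ∀ i j, 0 ≤ ∫ t in a..b, ‖(y i).der j t‖ := fun i j =>
    intervalIntegral.integral_nonneg hab.le fun _ _ => norm_nonneg _
  have hle : ∀ i, ∀ j ≤ r, ∫ t in a..b, ‖(y i).der j t‖ ≤ sobolevNorm y := fun i j hj =>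
    (Finset.single_le_sum (f := fun j => ∫ t in a..b, ‖(y i).der j t‖) (fun j _ => hnn i j)
      (Finset.mem_range.2 (by omega))).trans
    (Finset.single_le_sum
      (f := fun i => ∑ j ∈ Finset.range (r + 1), ∫ t in a..b, ‖(y i).der j t‖)
      (fun i _ => Finset.sum_nonneg fun j _ => hnn i j) (Finset.mem_univ i))
  refine norm_le_of_norm_der_le hr fun i j hj t ht => ?_
  refine (CSpace.norm_der_le_integral (hy i) hj ht).trans ?_
  have h1 := mul_le_mul_of_nonneg_left (hle i j hj.le) (inv_nonneg.2 h5.le)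
  have h2 := hle i (j + 1) hj
  linarith

/-! ### Linearity of the differential equation. -/

/-- `y` is a solution of class `(W_1^r)^m` of `Ly = f`. -/
structure SolvesEq (A : Coeffs a b r m) (f : L1Vec a b m) (y : CVec hab (r - 1) m) : Prop where
  memSobolev : ∀ i, (y i).MemSobolev
  equation : ∀ i, ∀ᵐ t ∂(volume.restrict (Icc a b)), diffExpr A y i t = f i t

theorem IsSolution.solvesEq {A : Coeffs a b r m} {B : CVec hab (r - 1) m →L[ℂ] CNum (r * m)}
    {f : L1Vec a b m} {q : CNum (r * m)} {y : CVec hab (r - 1) m} (h : IsSolution A B f q y) :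
    SolvesEq A f y := ⟨h.memSobolev, h.equation⟩

theorem SolvesEq.isSolution {A : Coeffs a b r m} {B : CVec hab (r - 1) m →L[ℂ] CNum (r * m)}
    {f : L1Vec a b m} {y : CVec hab (r - 1) m} (h : SolvesEq A f y) :
    IsSolution A B f (B y) y := ⟨h.memSobolev, h.equation, rfl⟩

namespace SolvesEq

variable {A : Coeffs a b r m} {f g : L1Vec a b m} {x y : CVec hab (r - 1) m}

theorem add (hx : SolvesEq A f x) (hy : SolvesEq A g y) : SolvesEq A (f + g) (x + y) := by
  refine ⟨fun i => (hx.memSobolev i).add (hy.memSobolev i), fun i => ?_⟩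
  have h1 : ∀ᵐ t ∂(volume.restrict (Icc a b)),
      ((x + y) i).der r t = (x i).der r t + (y i).der r t :=
    (ae_restrict_iff' measurableSet_Icc).2
      (CSpace.ae_der_add (hx.memSobolev i) (hy.memSobolev i) le_rfl)
  filter_upwards [hx.equation i, hy.equation i, h1, Lp.coeFn_add (f i) (g i),
    ae_restrict_mem measurableSet_Icc] with t e1 e2 e3 e4 ht
  have h2 : (f + g) i t = f i t + g i t := e4
  rw [h2, ← e1, ← e2]
  simp only [diffExpr]
  rw [e3, add_add_add_comm, ← Finset.sum_add_distrib]
  congr 1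
  refine Finset.sum_congr rfl fun j _ => ?_
  rw [← Finset.sum_add_distrib]
  refine Finset.sum_congr rfl fun s _ => ?_
  rw [← mul_add]
  congr 1
  exact CSpace.der_add (x s) (y s) (by omega) ht

theorem smul (c : ℂ) (hx : SolvesEq A f x) : SolvesEq A (c • f) (c • x) := by
  refine ⟨fun i => (hx.memSobolev i).smul c, fun i => ?_⟩
  have h1 : ∀ᵐ t ∂(volume.restrict (Icc a b)), ((c • x) i).der r t = c * (x i).der r t :=
    (ae_restrict_iff' measurableSet_Icc).2 (CSpace.ae_der_smul c (hx.memSobolev i) le_rfl)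
  filter_upwards [hx.equation i, h1, Lp.coeFn_smul c (f i),
    ae_restrict_mem measurableSet_Icc] with t e1 e3 e4 ht
  have h2 : (c • f) i t = c * f i t := e4
  rw [h2, ← e1]
  simp only [diffExpr]
  rw [e3, mul_add, Finset.mul_sum]
  congr 1
  refine Finset.sum_congr rfl fun j _ => ?_
  rw [Finset.mul_sum]
  refine Finset.sum_congr rfl fun s _ => ?_
  rw [mul_left_comm]
  congr 1
  exact CSpace.der_smul c (x s) (by omega) ht

theorem sub (hx : SolvesEq A f x) (hy : SolvesEq A g y) : SolvesEq A (f - g) (x - y) := by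
  have h := hx.add (hy.smul (-1))
  simpa only [neg_smul, one_smul, ← sub_eq_add_neg] using h

theorem zero : SolvesEq A 0 (0 : CVec hab (r - 1) m) := by
  have hac : ∀ i, ((0 : CVec hab (r - 1) m) i).MemSobolev := fun i => by
    have h : EqOn (fun _ : ℝ => (0 : ℂ)) (((0 : CVec hab (r - 1) m) i).der (r - 1))
        (uIcc a b) := fun t ht => by
      rw [uIcc_of_le hab.le] at ht
      -- The derivatives of the zero function are read off from `0 • 0 = 0`.
      have := CSpace.der_smul 0 (0 : CSpace hab (r - 1)) (le_refl (r - 1)) ht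
      rw [zero_smul, zero_mul] at this
      exact this.symm
    exact ((LipschitzWith.const (0 : ℂ)).lipschitzOnWith.absolutelyContinuousOnInterval).congr h
  have h0 : ∀ i, ∀ j ≤ r, ∀ᵐ t, t ∈ Icc a b → ((0 : CVec hab (r - 1) m) i).der j t = 0 :=
    fun i j hj => by
      have := CSpace.ae_der_smul 0 (hac i) hj
      simp only [zero_smul, zero_mul] at this
      exact this
  refine ⟨hac, fun i => ?_⟩
  have h1 : ∀ᵐ t ∂(volume.restrict (Icc a b)), ∀ i, ∀ j : Fin (r + 1),
      ((0 : CVec hab (r - 1) m) i).der j t = 0 :=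
    ae_all_iff.2 fun i => ae_all_iff.2 fun j =>
      (ae_restrict_iff' measurableSet_Icc).2 (h0 i j (by omega))
  filter_upwards [h1, Lp.coeFn_zero ℂ 1 (volume.restrict (Icc a b))] with t e1 e2
  have e3 : (0 : L1Vec a b m) i t = 0 := e2
  rw [e3]
  refine (congrArg₂ (· + ·) (e1 i (Fin.last r)) (Finset.sum_eq_zero fun j _ =>
    Finset.sum_eq_zero fun s _ => ?_)).trans (add_zero 0)
  exact (congrArg (A j i s t * ·) (e1 s j.castSucc)).trans (mul_zero _)

theorem sum_smul {ι : Type*} (s : Finset ι) (c : ι → ℂ) {y : ι → CVec hab (r - 1) m}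
    (hy : ∀ p, SolvesEq A 0 (y p)) : SolvesEq A 0 (∑ p ∈ s, c p • y p) := by
  classical
  induction s using Finset.induction_on with
  | empty => simpa using zero
  | insert p s hp ih =>
    rw [Finset.sum_insert hp]
    simpa using ((hy p).smul (c p)).add ih

end SolvesEq

/-! ### The Cauchy problem: estimate by the antiderivative, and uniqueness. -/

/-- The sum of the moduli of the coefficients. -/
def coeffNorm (A : Coeffs a b r m) (t : ℝ) : ℝ :=
  ∑ i : Fin m, ∑ j : Fin r, ∑ s : Fin m, ‖A j i s t‖

/-- The sum of the moduli of the derivatives of order less than `r` at the point `t`. -/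
def jetNorm (y : CVec hab (r - 1) m) (t : ℝ) : ℝ :=
  ∑ i : Fin m, ∑ j ∈ Finset.range r, ‖(y i).der j t‖

theorem coeffNorm_nonneg (A : Coeffs a b r m) (t : ℝ) : 0 ≤ coeffNorm A t :=
  Finset.sum_nonneg fun _ _ => Finset.sum_nonneg fun _ _ => Finset.sum_nonneg fun _ _ =>
    norm_nonneg _

theorem jetNorm_nonneg (y : CVec hab (r - 1) m) (t : ℝ) : 0 ≤ jetNorm y t :=
  Finset.sum_nonneg fun _ _ => Finset.sum_nonneg fun _ _ => norm_nonneg _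

theorem norm_der_le_jetNorm (y : CVec hab (r - 1) m) (t : ℝ) (i : Fin m) {j : ℕ} (hj : j < r) :
    ‖(y i).der j t‖ ≤ jetNorm y t :=
  (Finset.single_le_sum (f := fun j => ‖(y i).der j t‖) (fun _ _ => norm_nonneg _)
    (Finset.mem_range.2 hj)).trans
  (Finset.single_le_sum (f := fun i => ∑ j ∈ Finset.range r, ‖(y i).der j t‖)
    (fun _ _ => Finset.sum_nonneg fun _ _ => norm_nonneg _) (Finset.mem_univ i))

theorem integrableOn_coeff (A : Coeffs a b r m) (j : Fin r) (i s : Fin m) :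
    IntegrableOn (A j i s) (Icc a b) := L1.integrable_coeFn (A j i s)

theorem integrableOn_coeffNorm (A : Coeffs a b r m) : IntegrableOn (coeffNorm A) (Icc a b) :=
  integrable_finsetSum _ fun i _ => integrable_finsetSum _ fun j _ =>
    integrable_finsetSum _ fun s _ => (integrableOn_coeff A j i s).norm

theorem continuousOn_jetNorm (y : CVec hab (r - 1) m) : ContinuousOn (jetNorm y) (Icc a b) :=
  continuousOn_finsetSum _ fun i _ => continuousOn_finsetSum _ fun j hj =>
    ((y i).continuousOn_der (by have := Finset.mem_range.1 hj; omega)).norm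

end

end MultipointBVP

end

noncomputable section

namespace MultipointBVP

variable {a b : ℝ} {hab : a < b} {r m : ℕ}

namespace SolvesEq

variable {A : Coeffs a b r m} {f : L1Vec a b m} {w : CVec hab (r - 1) m} {c K : ℝ}

/-- Integrate from `c`. Each derivative of order below `r - 1` is bounded by the integral of the
next one, which produces the 1 in the kernel. Order `r - 1` is expressed through the equation, which
produces `coeffNorm`; `f` is kept under the integral sign without modulus. -/
theorem jetNorm_le_add_integral (hr : 1 ≤ r) (hw : SolvesEq A f w) (hc : c ∈ Icc a b)
    (h0 : ∀ i, ∀ j < r, (w i).der j c = 0) {t : ℝ} (ht : t ∈ Icc a b) :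
    jetNorm w t ≤ ∑ i, ‖∫ s in c..t, f i s‖
      + |∫ s in c..t, (1 + coeffNorm A s) * jetNorm w s| := by
  obtain ⟨n, rfl⟩ : ∃ n, r = n + 1 := ⟨r - 1, by omega⟩
  have hJ : uIoc c t ⊆ Icc a b := uIoc_subset_uIcc.trans (uIcc_subset_Icc hc ht)
  have hrep : ∀ i, ∀ j < n + 1, (w i).der j t = ∫ s in c..t, (w i).der (j + 1) s :=
    fun i j hj => by
      rw [CSpace.integral_der_succ (hw.memSobolev i) hj hc ht, h0 i j hj, sub_zero]
  have hu : IntegrableOn (jetNorm w) (uIoc c t) :=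
    (continuousOn_jetNorm w).integrableOn_Icc.mono_set hJ
  have hAu : IntegrableOn (fun s => coeffNorm A s * jetNorm w s) (uIoc c t) :=
    ((integrableOn_coeffNorm A).mul_continuousOn (continuousOn_jetNorm w) isCompact_Icc).mono_set hJ
  have hder : ∀ i, ∀ j < n + 1, IntegrableOn (fun s => ‖(w i).der j s‖) (uIoc c t) :=
    fun i j hj => (((w i).continuousOn_der (Nat.le_of_lt_succ hj)).norm.integrableOn_Icc).mono_set hJ
  have hAi : ∀ i, IntegrableOn (fun s => (∑ j, ∑ l, ‖A j i l s‖) * jetNorm w s) (uIoc c t) :=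
    fun i => by
      have h : IntegrableOn (fun s => ∑ j, ∑ l, ‖A j i l s‖) (Icc a b) :=
        integrable_finsetSum _ fun j _ => integrable_finsetSum _ fun l _ =>
          (integrableOn_coeff A j i l).norm
      exact (h.mul_continuousOn (continuousOn_jetNorm w) isCompact_Icc).mono_set hJ
  have hlow : ∑ i, ∑ j ∈ Finset.range n, ‖(w i).der j t‖ ≤ ∫ s in uIoc c t, jetNorm w s := by
    calc ∑ i, ∑ j ∈ Finset.range n, ‖(w i).der j t‖
        ≤ ∑ i, ∑ j ∈ Finset.range n, ∫ s in uIoc c t, ‖(w i).der (j + 1) s‖ :=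
          Finset.sum_le_sum fun i _ => Finset.sum_le_sum fun j hj => by
            rw [hrep i j (by have := Finset.mem_range.1 hj; omega)]
            exact intervalIntegral.norm_integral_le_integral_norm_uIoc
      _ = ∫ s in uIoc c t, ∑ i, ∑ j ∈ Finset.range n, ‖(w i).der (j + 1) s‖ := by
          have hj' : ∀ i, ∀ j ∈ Finset.range n,
              IntegrableOn (fun s => ‖(w i).der (j + 1) s‖) (uIoc c t) := fun i j hj =>
            hder i (j + 1) (by have := Finset.mem_range.1 hj; omega)
          rw [integral_finsetSum _ fun i _ => integrable_finsetSum _ (hj' i)]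
          exact Finset.sum_congr rfl fun i _ => (integral_finsetSum _ (hj' i)).symm
      _ ≤ ∫ s in uIoc c t, jetNorm w s := by
          refine setIntegral_mono (integrable_finsetSum _ fun i _ => integrable_finsetSum _
            fun j hj => hder i (j + 1) (by have := Finset.mem_range.1 hj; omega)) hu fun s => ?_
          refine Finset.sum_le_sum fun i _ => ?_
          -- The shifted sum runs over the orders `1, …, n`; `jetNorm` exceeds it by the term of
          -- order 0.
          rw [Finset.sum_range_succ' _ n]
          exact le_add_of_nonneg_right (norm_nonneg _)
  have htop : ∀ i, ‖(w i).der n t‖ ≤ ‖∫ s in c..t, f i s‖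
      + ∫ s in uIoc c t, (∑ j, ∑ l, ‖A j i l s‖) * jetNorm w s := fun i => by
    set g : ℝ → ℂ := fun s => ∑ j : Fin (n + 1), ∑ l, A j i l s * (w l).der j s with hg
    have hgint : IntegrableOn g (uIoc c t) :=
      (integrable_finsetSum _ fun j _ => integrable_finsetSum _ fun l _ =>
        ((integrableOn_coeff A j i l).mul_continuousOn
          ((w l).continuousOn_der (Nat.le_of_lt_succ j.2)) isCompact_Icc).mono_set hJ)
    have hfint : IntegrableOn (f i) (uIoc c t) :=
      IntegrableOn.mono_set (L1.integrable_coeFn (f i)) hJ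
    have heq : ∫ s in c..t, (w i).der (n + 1) s = ∫ s in c..t, (f i s - g s) := by
      refine intervalIntegral.integral_congr_ae ?_
      filter_upwards [(ae_restrict_iff' measurableSet_Icc).1 (hw.equation i)] with s h1 h2
      rw [← h1 (hJ h2)]
      simp only [diffExpr, hg, add_sub_cancel_right]
    rw [hrep i n (Nat.lt_succ_self n), heq, intervalIntegral.integral_sub
      (intervalIntegrable_iff.2 hfint) (intervalIntegrable_iff.2 hgint)]
    refine (norm_sub_le _ _).trans (add_le_add le_rfl ?_)
    refine intervalIntegral.norm_integral_le_integral_norm_uIoc.trans ?_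
    refine setIntegral_mono hgint.norm (hAi i) fun s => ?_
    simp only [hg, Finset.sum_mul]
    refine (norm_sum_le _ _).trans (Finset.sum_le_sum fun j _ => ?_)
    refine (norm_sum_le _ _).trans (Finset.sum_le_sum fun l _ => ?_)
    rw [norm_mul]
    exact mul_le_mul_of_nonneg_left (norm_der_le_jetNorm w s l j.2) (norm_nonneg _)
  have hR : |∫ s in c..t, (1 + coeffNorm A s) * jetNorm w s|
      = (∫ s in uIoc c t, jetNorm w s) + ∫ s in uIoc c t, coeffNorm A s * jetNorm w s := by
    rw [intervalIntegral.abs_integral_eq_abs_integral_uIoc, abs_of_nonneg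
      (setIntegral_nonneg measurableSet_uIoc fun s _ => mul_nonneg
        (add_nonneg zero_le_one (coeffNorm_nonneg A s)) (jetNorm_nonneg w s)),
      ← integral_add hu hAu]
    simp only [add_mul, one_mul]
  have hsum : ∑ i, ∫ s in uIoc c t, (∑ j, ∑ l, ‖A j i l s‖) * jetNorm w s
      = ∫ s in uIoc c t, coeffNorm A s * jetNorm w s := by
    rw [← integral_finsetSum _ fun i _ => hAi i]
    simp only [coeffNorm, Finset.sum_mul]
  have hsplit : jetNorm w t
      = ∑ i, ∑ j ∈ Finset.range n, ‖(w i).der j t‖ + ∑ i, ‖(w i).der n t‖ := by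
    rw [jetNorm, ← Finset.sum_add_distrib]
    exact Finset.sum_congr rfl fun i _ => Finset.sum_range_succ _ n
  have h1 := Finset.sum_le_sum fun i (_ : i ∈ Finset.univ) => htop i
  rw [Finset.sum_add_distrib, hsum] at h1
  rw [hsplit, hR]
  linarith

/-- A solution of `Lw = f` with vanishing Cauchy data at `c` is controlled by the antiderivative
of `f`. -/
theorem jetNorm_le (hr : 1 ≤ r) (hw : SolvesEq A f w) (hc : c ∈ Icc a b)
    (h0 : ∀ i, ∀ j < r, (w i).der j c = 0)
    (hK : ∀ t ∈ Icc a b, ∑ i, ‖∫ s in c..t, f i s‖ ≤ K) :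
    ∀ t ∈ Icc a b, jetNorm w t ≤ 2 * K * Real.exp (2 * ∫ s in a..b, (1 + coeffNorm A s)) :=
  le_mul_exp_of_le_add_abs_integral
    ((integrableOn_const (by simp)).add (integrableOn_coeffNorm A))
    (fun t => add_nonneg zero_le_one (coeffNorm_nonneg A t)) (continuousOn_jetNorm w)
    (jetNorm_nonneg w) hc fun t ht =>
      (hw.jetNorm_le_add_integral hr hc h0 ht).trans (add_le_add (hK t ht) le_rfl)

/-- Gronwall's inequality with `K = 0`. -/
theorem eq_zero (hr : 1 ≤ r) (hw : SolvesEq A 0 w) (hc : c ∈ Icc a b)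
    (h0 : ∀ i, ∀ j < r, (w i).der j c = 0) : w = 0 := by
  have h := hw.jetNorm_le hr hc h0 (K := 0) fun t ht => by
    refine (Finset.sum_eq_zero fun i _ => ?_).le
    rw [norm_eq_zero]
    refine intervalIntegral.integral_zero_ae ?_
    filter_upwards [(ae_restrict_iff' measurableSet_Icc).1
      (Lp.coeFn_zero ℂ 1 (volume.restrict (Icc a b)))] with s h1 h2
    exact h1 (uIcc_subset_Icc hc ht (uIoc_subset_uIcc h2))
  rw [← norm_le_zero_iff]
  refine (norm_le_of_norm_der_le hr (C := 0) fun i j hj t ht => ?_).trans (by simp)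
  exact (norm_der_le_jetNorm w t i hj).trans ((h t ht).trans (by simp))

theorem norm_le (hr : 1 ≤ r) (hw : SolvesEq A f w) (h0 : ∀ i, ∀ j < r, (w i).der j a = 0) :
    ‖w‖ ≤ m * (r * (2 * ‖antideriv hab f‖
      * Real.exp (2 * ∫ s in a..b, (1 + coeffNorm A s)))) := by
  refine norm_le_of_norm_der_le hr fun i j hj t ht => (norm_der_le_jetNorm w t i hj).trans ?_
  refine hw.jetNorm_le hr (left_mem_Icc.2 hab.le) h0 (fun t ht => ?_) t ht
  rw [PiLp.norm_eq_of_L1]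
  exact Finset.sum_le_sum fun i _ => (antideriv hab f i).norm_coe_le_norm ⟨t, ht⟩

end SolvesEq

end MultipointBVP

end

/-! ### Perturbation of invertible matrices. -/

open scoped Matrix in
theorem Matrix.sum_norm_vecMul_le {ι κ : Type*} [Fintype ι] [Fintype κ] (x : ι → ℂ)
    {V : Matrix ι κ ℂ} {M : ℝ} (hV : ∀ p q, ‖V p q‖ ≤ M) :
    ∑ q, ‖(x ᵥ* V) q‖ ≤ Fintype.card κ * M * ∑ p, ‖x p‖ := by
  have h : ∀ q, ‖(x ᵥ* V) q‖ ≤ M * ∑ p, ‖x p‖ := fun q => by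
    rw [Finset.mul_sum]
    refine (norm_sum_le _ _).trans (Finset.sum_le_sum fun p _ => ?_)
    rw [norm_mul, mul_comm]
    exact mul_le_mul_of_nonneg_right (hV p q) (norm_nonneg _)
  refine (Finset.sum_le_sum fun q _ => h q).trans_eq ?_
  simp [mul_assoc]

open scoped Matrix in
/-- A lower bound for `ρ ↦ ρ W'` when `W'` is close to a right invertible matrix. -/
theorem Matrix.sum_norm_le_of_close {ι : Type*} [Fintype ι] [DecidableEq ι] {W W' V : Matrix ι ι ℂ}
    {M η : ℝ} (hWV : W * V = 1) (hV : ∀ p q, ‖V p q‖ ≤ M) (hη : ∀ p q, ‖(W - W') p q‖ ≤ η)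
    (hM : 0 ≤ M) (hsmall : Fintype.card ι * M * (Fintype.card ι * η) ≤ 1 / 2) (ρ : ι → ℂ) :
    ∑ p, ‖ρ p‖ ≤ 2 * (Fintype.card ι * M * ∑ p, ‖(ρ ᵥ* W') p‖) := by
  -- By `hsmall` the second summand has at most half the norm of `ρ` and moves to the left-hand
  -- side.
  have h1 : ρ = (ρ ᵥ* W') ᵥ* V + (ρ ᵥ* (W - W')) ᵥ* V := by
    rw [← Matrix.add_vecMul, ← Matrix.vecMul_add, add_sub_cancel, Matrix.vecMul_vecMul, hWV,
      Matrix.vecMul_one]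
  have h2 : ∑ p, ‖ρ p‖ ≤ ∑ p, ‖((ρ ᵥ* W') ᵥ* V) p‖ + ∑ p, ‖((ρ ᵥ* (W - W')) ᵥ* V) p‖ := by
    rw [← Finset.sum_add_distrib]
    refine Finset.sum_le_sum fun p _ => ?_
    conv_lhs => rw [h1]
    exact norm_add_le _ _
  have h3 := Matrix.sum_norm_vecMul_le (ρ ᵥ* W') hV
  have h4 := Matrix.sum_norm_vecMul_le (ρ ᵥ* (W - W')) hV
  have h5 := Matrix.sum_norm_vecMul_le ρ hη
  have h6 : Fintype.card ι * M * ∑ p, ‖(ρ ᵥ* (W - W')) p‖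
      ≤ Fintype.card ι * M * (Fintype.card ι * η * ∑ p, ‖ρ p‖) := by gcongr
  have h7 : Fintype.card ι * M * (Fintype.card ι * η) * ∑ p, ‖ρ p‖ ≤ 1 / 2 * ∑ p, ‖ρ p‖ :=
    mul_le_mul_of_nonneg_right hsmall (Finset.sum_nonneg fun _ _ => norm_nonneg _)
  linarith

/-! ### Fundamental systems and the Wronski matrix. -/

noncomputable section

namespace MultipointBVP

variable {a b : ℝ} {hab : a < b} {r m : ℕ}

/-- The standard basis of `ℂ^{rm}`, indexed by pairs. -/
def stdVec (p : Fin r × Fin m) : CNum (r * m) := PiLp.single 1 (finProdFinEquiv p) 1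

theorem norm_stdVec (p : Fin r × Fin m) : ‖stdVec p‖ = 1 := by
  simp [stdVec]

theorem norm_sum_smul_stdVec (c : Fin r × Fin m → ℂ) : ‖∑ p, c p • stdVec p‖ = ∑ p, ‖c p‖ := by
  rw [PiLp.norm_eq_of_L1, ← finProdFinEquiv.sum_comp]
  refine Finset.sum_congr rfl fun q _ => ?_
  congr 1
  simp [stdVec, Pi.single_apply]

theorem der_sum_smul {ι : Type*} (s : Finset ι) (c : ι → ℂ) (Y : ι → CVec hab (r - 1) m)
    (i : Fin m) {j : ℕ} (hj : j < r) {t : ℝ} (ht : t ∈ Icc a b) :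
    ((∑ q ∈ s, c q • Y q) i).der j t = ∑ q ∈ s, c q * (Y q i).der j t := by
  classical
  induction s using Finset.induction_on with
  | empty =>
    have := CSpace.der_smul 0 (0 : CSpace hab (r - 1)) (Nat.le_sub_one_of_lt hj) ht
    simp only [zero_smul, zero_mul] at this
    simpa using this
  | insert p s hp ih =>
    rw [Finset.sum_insert hp, Finset.sum_insert hp, ← ih]
    refine (CSpace.der_add (c p • Y p i) ((∑ q ∈ s, c q • Y q) i) (by omega) ht).trans ?_
    rw [CSpace.der_smul _ _ (by omega) ht]

theorem der_sub (x y : CVec hab (r - 1) m) (i : Fin m) {j : ℕ} (hj : j < r) {t : ℝ}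
    (ht : t ∈ Icc a b) : ((x - y) i).der j t = (x i).der j t - (y i).der j t := by
  have h := CSpace.der_add ((x - y) i) (y i) (by omega : j ≤ r - 1) ht
  have h2 : (x - y) i + y i = x i := sub_add_cancel (x i) (y i)
  rw [h2] at h
  rw [h, add_sub_cancel_right]

/-- The Wronski matrix of a family of `rm` vector-functions. -/
def wronskian (Y : Fin r × Fin m → CVec hab (r - 1) m) (t : ℝ) :
    Matrix (Fin r × Fin m) (Fin r × Fin m) ℂ :=
  Matrix.of fun p q => (Y q p.2).der p.1 t

open scoped Matrix

theorem wronskian_mulVec (Y : Fin r × Fin m → CVec hab (r - 1) m) {t : ℝ} (ht : t ∈ Icc a b)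
    (c : Fin r × Fin m → ℂ) (p : Fin r × Fin m) :
    (wronskian Y t *ᵥ c) p = ((∑ q, c q • Y q) p.2).der p.1 t := by
  rw [der_sum_smul _ _ _ _ p.1.2 ht]
  exact Finset.sum_congr rfl fun q _ => mul_comm _ _

variable {A : Coeffs a b r m} {B : CVec hab (r - 1) m →L[ℂ] CNum (r * m)}
  {Y : Fin r × Fin m → CVec hab (r - 1) m}

/-- A kernel vector `c` gives a combination with zero Cauchy data at `t`, which therefore vanishes
identically; applying `B` to it returns `c`. -/
theorem det_wronskian_ne_zero (hr : 1 ≤ r) (hY : ∀ q, IsSolution A B 0 (stdVec q) (Y q)) {t : ℝ}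
    (ht : t ∈ Icc a b) : (wronskian Y t).det ≠ 0 := by
  intro hdet
  obtain ⟨c, hc, hWc⟩ := Matrix.exists_mulVec_eq_zero_iff.2 hdet
  have h0 : ∑ q, c q • Y q = 0 :=
    (SolvesEq.sum_smul Finset.univ c fun q => (hY q).solvesEq).eq_zero hr ht fun i j hj => by
      rw [← wronskian_mulVec Y ht c (⟨j, hj⟩, i), hWc]; rfl
  have h1 : ∑ q, c q • (stdVec q : CNum (r * m)) = 0 := by
    have := congrArg B h0
    simpa [(hY _).boundary] using this
  have h2 := norm_sum_smul_stdVec c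
  rw [h1, norm_zero] at h2
  refine hc (funext fun q => ?_)
  exact norm_eq_zero.1 ((Finset.sum_eq_zero_iff_of_nonneg fun _ _ => norm_nonneg _).1 h2.symm q
    (Finset.mem_univ q))

theorem continuousOn_wronskian (Y : Fin r × Fin m → CVec hab (r - 1) m) :
    ContinuousOn (wronskian Y) (Icc a b) :=
  continuousOn_pi.2 fun p => continuousOn_pi.2 fun q =>
    (Y q p.2).continuousOn_der (Nat.le_sub_one_of_lt p.1.2)

/-- By the adjugate formula the inverse is continuous on the compact interval. -/
theorem exists_bound_inv_wronskian (hr : 1 ≤ r) (hY : ∀ q, IsSolution A B 0 (stdVec q) (Y q)) :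
    ∃ M, 0 ≤ M ∧ ∀ t ∈ Icc a b, ∀ p q, ‖(wronskian Y t)⁻¹ p q‖ ≤ M := by
  have hW := continuousOn_wronskian Y
  have hcont : ContinuousOn (fun t => (wronskian Y t)⁻¹) (Icc a b) := by
    simp only [Matrix.inv_def, Ring.inverse_eq_inv']
    exact ((continuous_id.matrix_det.comp_continuousOn hW).inv₀ fun t ht =>
      det_wronskian_ne_zero hr hY ht).smul (continuous_id.matrix_adjugate.comp_continuousOn hW)
  have hc : ContinuousOn (fun t => ∑ p, ∑ q, ‖(wronskian Y t)⁻¹ p q‖) (Icc a b) :=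
    continuousOn_finsetSum _ fun p _ => continuousOn_finsetSum _ fun q _ =>
      (continuousOn_pi.1 (continuousOn_pi.1 hcont p) q).norm
  obtain ⟨M, hM⟩ := (isCompact_Icc.image_of_continuousOn hc).bddAbove
  have hM' : ∀ t ∈ Icc a b, ∑ p, ∑ q, ‖(wronskian Y t)⁻¹ p q‖ ≤ M := fun t ht =>
    hM (mem_image_of_mem _ ht)
  refine ⟨M, (Finset.sum_nonneg fun _ _ => Finset.sum_nonneg fun _ _ => norm_nonneg _).trans
    (hM' a (left_mem_Icc.2 hab.le)), fun t ht p q => le_trans ?_ (hM' t ht)⟩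
  exact (Finset.single_le_sum (f := fun q => ‖(wronskian Y t)⁻¹ p q‖)
    (fun _ _ => norm_nonneg _) (Finset.mem_univ q)).trans
    (Finset.single_le_sum (f := fun p => ∑ q, ‖(wronskian Y t)⁻¹ p q‖)
      (fun _ _ => Finset.sum_nonneg fun _ _ => norm_nonneg _) (Finset.mem_univ p))

theorem CSpace.MemSobolev.intervalIntegrable_norm_der {x : CSpace hab (r - 1)} (hr : 1 ≤ r)
    (hx : x.MemSobolev) : IntervalIntegrable (fun t => ‖x.der r t‖) volume a b := by
  have h := intervalIntegrable_der_succ hx (j := r - 1) (by omega)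
    (left_mem_Icc.2 hab.le) (right_mem_Icc.2 hab.le)
  rw [Nat.sub_add_cancel hr] at h
  exact h.norm

theorem sum_integral_norm_der_le_sobolevNorm (y : CVec hab (r - 1) m) :
    ∑ i, ∫ t in a..b, ‖(y i).der r t‖ ≤ sobolevNorm y :=
  Finset.sum_le_sum fun i _ => Finset.single_le_sum
    (f := fun j => ∫ t in a..b, ‖(y i).der j t‖)
    (fun _ _ => intervalIntegral.integral_nonneg hab.le fun _ _ => norm_nonneg _)
    (Finset.self_mem_range_succ r)

theorem sum_integral_norm_der_le {x y : CVec hab (r - 1) m} (hr : 1 ≤ r)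
    (hx : ∀ i, (x i).MemSobolev) (hy : ∀ i, (y i).MemSobolev) :
    ∑ i, ∫ t in a..b, ‖((x + y) i).der r t‖ ≤ sobolevNorm x + sobolevNorm y := by
  refine le_trans ?_ (add_le_add (sum_integral_norm_der_le_sobolevNorm x)
    (sum_integral_norm_der_le_sobolevNorm y))
  rw [← Finset.sum_add_distrib]
  refine Finset.sum_le_sum fun i _ => ?_
  rw [← intervalIntegral.integral_add ((hx i).intervalIntegrable_norm_der hr)
    ((hy i).intervalIntegrable_norm_der hr)]
  refine intervalIntegral.integral_mono_ae_restrict hab.le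
    (((hx i).add (hy i)).intervalIntegrable_norm_der hr)
    (((hx i).intervalIntegrable_norm_der hr).add ((hy i).intervalIntegrable_norm_der hr)) ?_
  refine (ae_restrict_iff' measurableSet_Icc).2 ?_
  filter_upwards [CSpace.ae_der_add (hx i) (hy i) le_rfl] with t h1 ht
  exact (congrArg norm (h1 ht)).trans_le (norm_add_le _ _)

/-! ### Bounding the coefficients through the solutions. -/

/-- The coefficients of a differential expression are bounded in `L_1` as long as a fundamental
system of solutions stays close to a given one. -/
theorem exists_integral_coeffNorm_le (hr : 1 ≤ r)
    (hY : ∀ q, IsSolution A B 0 (stdVec q) (Y q)) :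
    ∃ η > 0, ∃ D, ∀ (A' : Coeffs a b r m) (Y' : Fin r × Fin m → CVec hab (r - 1) m),
      (∀ q, SolvesEq A' 0 (Y' q)) → (∀ q, ‖Y' q - Y q‖ ≤ η) →
      (∀ q, sobolevNorm (Y' q - Y q) ≤ 1) → ∫ t in a..b, (1 + coeffNorm A' t) ≤ D := by
  obtain ⟨M, hM0, hM⟩ := exists_bound_inv_wronskian hr hY
  set N : ℝ := (Fintype.card (Fin r × Fin m) : ℝ) with hN
  have hN0 : 0 ≤ N := Nat.cast_nonneg _
  -- The first witness makes `N * M * (N * η) ≤ 1 / 2`, as the perturbation lemma requires. In the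
  -- second, `b - a` is the integral of 1, and the sum bounds the integrals of the `r`-th
  -- derivatives of `Y'`.
  refine ⟨1 / (2 * (N * M * N + 1)), by positivity,
    (b - a) + 2 * (N * M * ∑ q, (sobolevNorm (Y q) + 1)), fun A' Y' hY' hclose hsob => ?_⟩
  set η : ℝ := 1 / (2 * (N * M * N + 1)) with hη
  have hsmall : N * M * (N * η) ≤ 1 / 2 := by
    rw [hη, show N * M * (N * (1 / (2 * (N * M * N + 1)))) = (N * M * N) / (2 * (N * M * N + 1)) by
      ring, div_le_div_iff₀ (by positivity) (by norm_num)]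
    linarith
  have hpt : ∀ᵐ t ∂(volume.restrict (Icc a b)),
      coeffNorm A' t ≤ ∑ q, ∑ i, 2 * (N * M * ‖(Y' q i).der r t‖) := by
    have hall : ∀ᵐ t ∂(volume.restrict (Icc a b)), ∀ q i, diffExpr A' (Y' q) i t = 0 :=
      ae_all_iff.2 fun q => ae_all_iff.2 fun i => by
        filter_upwards [(hY' q).equation i, Lp.coeFn_zero ℂ 1 (volume.restrict (Icc a b))]
          with t h1 h2
        exact h1.trans h2
    filter_upwards [hall, ae_restrict_mem measurableSet_Icc] with t h1 ht
    rw [Finset.sum_comm]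
    refine Finset.sum_le_sum fun i _ => ?_
    have h2 := Matrix.sum_norm_le_of_close (W := wronskian Y t) (W' := wronskian Y' t)
      (Matrix.mul_nonsing_inv _ (isUnit_iff_ne_zero.2 (det_wronskian_ne_zero hr hY ht)))
      (hM t ht) (η := η) (fun p q => by
        have h3 : (wronskian Y' t - wronskian Y t) p q = ((Y' q - Y q) p.2).der p.1 t :=
          (der_sub (Y' q) (Y q) p.2 p.1.2 ht).symm
        rw [← neg_sub (wronskian Y' t), Matrix.neg_apply, norm_neg, h3]
        exact (norm_der_le_norm _ _ p.1.2 ht).trans (hclose q))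
      hM0 hsmall (fun p => A' p.1 i p.2 t)
    rw [Fintype.sum_prod_type] at h2
    refine h2.trans_eq ?_
    rw [← Finset.mul_sum, ← Finset.mul_sum]
    congr 2
    refine Finset.sum_congr rfl fun q _ => ?_
    -- The homogeneous equation, read as a linear system for the `i`-th row of coefficients.
    have h4 : (Y' q i).der r t = -((fun p : Fin r × Fin m => A' p.1 i p.2 t) ᵥ* wronskian Y' t) q := by
      rw [eq_neg_iff_add_eq_zero, ← h1 q i, diffExpr]
      congr 1
      exact Fintype.sum_prod_type _
    rw [h4, norm_neg]
  have hAint : IntervalIntegrable (coeffNorm A') volume a b :=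
    (intervalIntegrable_iff_integrableOn_Icc_of_le hab.le).2 (integrableOn_coeffNorm A')
  have hYint : ∀ q i, IntervalIntegrable (fun t => 2 * (N * M * ‖(Y' q i).der r t‖)) volume a b :=
    fun q i => ((((hY' q).memSobolev i).intervalIntegrable_norm_der hr).const_mul _).const_mul _
  have hYint' : ∀ q, IntervalIntegrable (fun t => ∑ i, 2 * (N * M * ‖(Y' q i).der r t‖))
      volume a b := fun q => by
    simpa only [Finset.sum_fn] using IntervalIntegrable.sum Finset.univ fun i _ => hYint q i
  have h1 := intervalIntegral.integral_mono_ae_restrict hab.le hAint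
    (g := fun t => ∑ q, ∑ i, 2 * (N * M * ‖(Y' q i).der r t‖))
    (by simpa only [Finset.sum_fn] using IntervalIntegrable.sum Finset.univ fun q _ => hYint' q) hpt
  rw [intervalIntegral.integral_add intervalIntegrable_const hAint]
  simp only [intervalIntegral.integral_const, smul_eq_mul, mul_one]
  refine add_le_add le_rfl (h1.trans ?_)
  have h2 : ∀ q, ∑ i, ∫ t in a..b, ‖(Y' q i).der r t‖ ≤ sobolevNorm (Y q) + 1 := fun q => by
    have h3 := sum_integral_norm_der_le hr (hY q).memSobolev
      (x := Y q) (y := Y' q - Y q) fun i => ?_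
    · rw [add_sub_cancel] at h3
      exact h3.trans (add_le_add le_rfl (hsob q))
    · exact ((hY' q).memSobolev i).sub ((hY q).memSobolev i)
  rw [intervalIntegral.integral_finsetSum fun q _ => hYint' q, Finset.mul_sum, Finset.mul_sum]
  refine Finset.sum_le_sum fun q _ => ?_
  rw [intervalIntegral.integral_finsetSum fun i _ => hYint q i]
  simp only [intervalIntegral.integral_const_mul]
  rw [← Finset.mul_sum, ← Finset.mul_sum]
  have := h2 q
  gcongr

end MultipointBVP

end

/-! ### The uniform a priori estimate. -/

noncomputable section

namespace MultipointBVP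

open scoped Matrix

variable {a b : ℝ} {hab : a < b} {r m : ℕ}

theorem antideriv_sub (f g : L1Vec a b m) :
    antideriv hab (f - g) = antideriv hab f - antideriv hab g := by
  ext i t
  have hsub : uIcc a (t : ℝ) ⊆ Icc a b := uIcc_subset_Icc (left_mem_Icc.2 hab.le) t.2
  have hint : ∀ h : L1Vec a b m, IntervalIntegrable (h i) volume a t := fun h =>
    (IntegrableOn.mono_set (L1.integrable_coeFn (h i)) hsub).intervalIntegrable
  change ∫ s in a..t, (f - g) i s = (∫ s in a..t, f i s) - ∫ s in a..t, g i s
  rw [← intervalIntegral.integral_sub (hint f) (hint g)]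
  refine intervalIntegral.integral_congr_ae ?_
  filter_upwards [(ae_restrict_iff' measurableSet_Icc).1 (Lp.coeFn_sub (f i) (g i))] with s h1 h2
  exact h1 (hsub (uIoc_subset_uIcc h2))

variable {A : Coeffs a b r m} {B : CVec hab (r - 1) m →L[ℂ] CNum (r * m)}
  {Y : Fin r × Fin m → CVec hab (r - 1) m}

/-- Subtracting a suitable solution of the homogeneous equation annihilates the Cauchy data
at `t`. -/
theorem exists_der_sub_sum_eq_zero (hr : 1 ≤ r)
    (hY : ∀ q, IsSolution A B 0 (stdVec q) (Y q)) (z : CVec hab (r - 1) m) {t : ℝ}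
    (ht : t ∈ Icc a b) : ∃ c : Fin r × Fin m → ℂ,
      ∀ i, ∀ j < r, ((z - ∑ q, c q • Y q) i).der j t = 0 := by
  refine ⟨(wronskian Y t)⁻¹ *ᵥ fun p => (z p.2).der p.1 t, fun i j hj => ?_⟩
  rw [der_sub _ _ i hj ht, sub_eq_zero]
  have h := wronskian_mulVec Y ht ((wronskian Y t)⁻¹ *ᵥ fun p => (z p.2).der p.1 t) (⟨j, hj⟩, i)
  rw [Matrix.mulVec_mulVec, Matrix.mul_nonsing_inv _
    (isUnit_iff_ne_zero.2 (det_wronskian_ne_zero hr hY ht)), Matrix.one_mulVec] at h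
  exact h

/-- An a priori estimate by the antiderivative of the right-hand side, uniform with respect to
the boundary-value problems whose fundamental solutions are close to those of a fixed problem. -/
theorem exists_norm_le_of_close (hr : 1 ≤ r) (hm : 1 ≤ m)
    (hY : ∀ q, IsSolution A B 0 (stdVec q) (Y q)) :
    ∃ η > 0, ∃ C > 0, ∀ (A' : Coeffs a b r m) (B' : CVec hab (r - 1) m →L[ℂ] CNum (r * m))
      (Y' : Fin r × Fin m → CVec hab (r - 1) m),
      (∀ q, IsSolution A' B' 0 (stdVec q) (Y' q)) → (∀ q, ‖Y' q - Y q‖ ≤ η) →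
      (∀ q, sobolevNorm (Y' q - Y q) ≤ 1) → ∀ σ : ℝ, ‖B'‖ ≤ σ → 0 < σ ∧
      ∀ (g : L1Vec a b m) (p : CNum (r * m)) (z : CVec hab (r - 1) m), IsSolution A' B' g p z →
        ∀ ε, ‖antideriv hab g‖ ≤ ε → ‖p‖ ≤ ε → ‖z‖ ≤ C * σ * ε := by
  obtain ⟨η, hη, D, hD⟩ := exists_integral_coeffNorm_le hr hY
  set R : ℝ := ∑ q, ‖Y q‖ + η with hR
  have hR0 : 0 < R := add_pos_of_nonneg_of_pos (Finset.sum_nonneg fun _ _ => norm_nonneg _) hη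
  set C₁ : ℝ := m * (r * (2 * Real.exp (2 * D))) with hC₁
  have hC₁0 : 0 ≤ C₁ := by positivity
  -- The three products absorb `C₁ * ε`, `ε * R` and `σ * (C₁ * ε) * R` in `hzn`; the first two gain
  -- the missing factor `σ` from `1 ≤ σ * R`.
  refine ⟨η, hη, C₁ * R + R * R + C₁ * R + 1, by positivity,
    fun A' B' Y' hY' hclose hsob σ hσ => ?_⟩
  have hY'R : ∀ q, ‖Y' q‖ ≤ R := fun q => by
    have h1 := norm_add_le (Y q) (Y' q - Y q)
    rw [add_sub_cancel] at h1
    exact h1.trans (add_le_add (Finset.single_le_sum (f := fun q => ‖Y q‖)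
      (fun _ _ => norm_nonneg _) (Finset.mem_univ q)) (hclose q))
  have hσ0 : 0 ≤ σ := (norm_nonneg _).trans hσ
  have hσR : 1 ≤ σ * R := by
    -- Any one fundamental solution bounds `σ` below: its image under `B'` has norm 1, its own norm
    -- is at most `R`.
    set q₀ : Fin r × Fin m := (⟨0, hr⟩, ⟨0, hm⟩)
    calc (1 : ℝ) = ‖B' (Y' q₀)‖ := by rw [(hY' q₀).boundary, norm_stdVec]
      _ ≤ ‖B'‖ * ‖Y' q₀‖ := B'.le_opNorm _
      _ ≤ σ * R := mul_le_mul hσ (hY'R q₀) (norm_nonneg _) hσ0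
  refine ⟨pos_of_mul_pos_left (zero_lt_one.trans_le hσR) hR0.le, fun g p z hz ε hg hp => ?_⟩
  have hε0 : 0 ≤ ε := (norm_nonneg _).trans hp
  obtain ⟨c, hc⟩ := exists_der_sub_sum_eq_zero hr hY' z (left_mem_Icc.2 hab.le)
  set v := ∑ q, c q • Y' q with hv
  have hw : SolvesEq A' g (z - v) := by
    have h := hz.solvesEq.sub (SolvesEq.sum_smul Finset.univ c fun q => (hY' q).solvesEq)
    rwa [sub_zero] at h
  have hwn : ‖z - v‖ ≤ C₁ * ε := by
    refine (hw.norm_le hr hc).trans ?_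
    have h1 : Real.exp (2 * ∫ s in a..b, (1 + coeffNorm A' s)) ≤ Real.exp (2 * D) :=
      Real.exp_le_exp.2 (mul_le_mul_of_nonneg_left
        (hD A' Y' (fun q => (hY' q).solvesEq) hclose hsob) zero_le_two)
    calc _ ≤ m * (r * (2 * ε * Real.exp (2 * D))) := by gcongr
      _ = C₁ * ε := by rw [hC₁]; ring
  -- The boundary operator returns the coefficients of `v`, so they are bounded through `B' v = p -
  -- B' (z - v)`.
  have hBv : B' v = ∑ q, c q • stdVec q := by
    simp [hv, (hY' _).boundary]
  have hcn : ∑ q, ‖c q‖ ≤ ε + σ * (C₁ * ε) := by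
    rw [← norm_sum_smul_stdVec, ← hBv]
    have h1 : B' v = p - B' (z - v) := by rw [map_sub, hz.boundary]; abel
    rw [h1]
    refine (norm_sub_le _ _).trans (add_le_add hp ((B'.le_opNorm _).trans ?_))
    exact mul_le_mul hσ hwn (norm_nonneg _) hσ0
  have hvn : ‖v‖ ≤ (ε + σ * (C₁ * ε)) * R := by
    refine (norm_sum_le _ _).trans ?_
    refine le_trans ?_ (mul_le_mul_of_nonneg_right hcn hR0.le)
    rw [Finset.sum_mul]
    refine Finset.sum_le_sum fun q _ => ?_
    rw [norm_smul]
    exact mul_le_mul_of_nonneg_left (hY'R q) (norm_nonneg _)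
  have hzn : ‖z‖ ≤ C₁ * ε + (ε + σ * (C₁ * ε)) * R := by
    have h1 := norm_add_le (z - v) v
    rw [sub_add_cancel] at h1
    linarith
  have h1 : C₁ * ε ≤ C₁ * ε * (σ * R) := le_mul_of_one_le_right (by positivity) hσR
  have h2 : ε * R ≤ ε * R * (σ * R) := le_mul_of_one_le_right (by positivity) hσR
  have h3 : 0 ≤ σ * ε := by positivity
  linarith

/-! ### Convergence of the approximating problems. -/

theorem IsApproximating.exists_tendsto {Ak : ℕ → Coeffs a b r m}
    {Bk : ℕ → CVec hab (r - 1) m →L[ℂ] CNum (r * m)} {ϱ₀ : ℕ}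
    (h : IsApproximating A B Ak Bk ϱ₀) (hr : 1 ≤ r) {f : L1Vec a b m} {q : CNum (r * m)}
    {y : CVec hab (r - 1) m} (hy : IsSolution A B f q y) :
    ∃ yk : ℕ → CVec hab (r - 1) m, (∀ k, ϱ₀ ≤ k → IsSolution (Ak k) (Bk k) f q (yk k)) ∧
      Tendsto (fun k => sobolevNorm (yk k - y)) atTop (𝓝 0) ∧
      Tendsto (fun k => ‖yk k - y‖) atTop (𝓝 0) := by
  have hex : ∀ k, ∃ x, ϱ₀ ≤ k → IsSolution (Ak k) (Bk k) f q x := fun k => by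
    by_cases hk : ϱ₀ ≤ k
    · obtain ⟨x, hx, -⟩ := h.uniquelySolvable k hk f q
      exact ⟨x, fun _ => hx⟩
    · exact ⟨0, fun hk' => absurd hk' hk⟩
  choose yk hyk using hex
  have ht := h.tendsto f q y yk hy hyk
  refine ⟨yk, hyk, ht, ?_⟩
  have ht' : Tendsto (fun k => (m : ℝ) * (r * (((b - a)⁻¹ + 1) * sobolevNorm (yk k - y))))
      atTop (𝓝 0) := by
    simpa using ((ht.const_mul ((b - a)⁻¹ + 1)).const_mul (r : ℝ)).const_mul (m : ℝ)
  refine squeeze_zero' (Eventually.of_forall fun _ => norm_nonneg _) ?_ ht'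
  filter_upwards [eventually_ge_atTop ϱ₀] with k hk
  exact norm_le_sobolevNorm hr fun i => ((hyk k hk).memSobolev i).sub (hy.memSobolev i)

theorem exists_const_norm_sub_lt (hr : 1 ≤ r) (hm : 1 ≤ m) (hAB : UniquelySolvable A B) :
    ∃ κ : ℝ, 0 < κ ∧
      ∀ (Ak : ℕ → Coeffs a b r m) (Bk : ℕ → CVec hab (r - 1) m →L[ℂ] CNum (r * m))
        (ϱ₀ : ℕ), IsApproximating A B Ak Bk ϱ₀ →
      ∀ (ϱ₁ : ℕ), ϱ₀ ≤ ϱ₁ →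
      ∀ (σ : ℝ), IsLUB {c : ℝ | ∃ k, ϱ₁ ≤ k ∧ c = ‖Bk k‖} σ →
      ∀ (ε : ℝ), 0 < ε →
      ∀ (f : L1Vec a b m) (q : CNum (r * m)) (y : CVec hab (r - 1) m), IsSolution A B f q y →
      ∃ ϱ : ℕ, 0 < ϱ ∧ ϱ₁ ≤ ϱ ∧
        ∀ (fk : ℕ → L1Vec a b m) (qk : ℕ → CNum (r * m)) (xk : ℕ → CVec hab (r - 1) m),
        (∀ k, ϱ₁ ≤ k → IsSolution (Ak k) (Bk k) (fk k) (qk k) (xk k)) →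
        (∀ k, ϱ₁ ≤ k → ‖antideriv hab (fk k) - antideriv hab f‖ < ε ∧ ‖qk k - q‖ < ε) →
        ∀ k, ϱ ≤ k → ‖xk k - y‖ < κ * σ * ε := by
  choose Y hY using fun p : Fin r × Fin m => (hAB 0 (stdVec p)).exists
  obtain ⟨η, hη, C, hC, H⟩ := exists_norm_le_of_close hr hm hY
  -- `C` serves `x_k - y_k`; the extra 1 serves `y_k - y`, which is eventually smaller than `σ * ε`.
  refine ⟨C + 1, by positivity, fun Ak Bk ϱ₀ happ ϱ₁ hϱ σ hσ ε hε f q y hy => ?_⟩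
  choose Yk hYk hYs hYn using fun p => happ.exists_tendsto hr (hY p)
  obtain ⟨yk, hyk, -, hyn⟩ := happ.exists_tendsto hr hy
  have hev : ∀ᶠ k in atTop, ϱ₁ ≤ k ∧ ∀ p, ‖Yk p k - Y p‖ ≤ η ∧ sobolevNorm (Yk p k - Y p) ≤ 1 :=
    (eventually_ge_atTop ϱ₁).and (eventually_all.2 fun p =>
      ((hYn p).eventually_le_const hη).and ((hYs p).eventually_le_const one_pos))
  have hclose : ∀ᶠ k in atTop, _ := hev.mono fun k hk =>
    H (Ak k) (Bk k) (fun p => Yk p k) (fun p => hYk p k (hϱ.trans hk.1)) (fun p => (hk.2 p).1)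
      (fun p => (hk.2 p).2) σ (hσ.1 ⟨k, hk.1, rfl⟩)
  have hσ0 : 0 < σ := let ⟨k, hk⟩ := hclose.exists; hk.1
  -- The index is fixed before `fk` and `qk` appear: it involves only the fundamental solutions,
  -- `yk`, `σ` and `ε`.
  obtain ⟨ϱ, hϱ'⟩ := eventually_atTop.1 ((hclose.and (hyn.eventually_lt_const
    (mul_pos hσ0 hε))).and ((eventually_ge_atTop ϱ₁).and (eventually_gt_atTop 0)))
  refine ⟨ϱ, (hϱ' ϱ le_rfl).2.2, (hϱ' ϱ le_rfl).2.1, fun fk qk xk hxk hfq k hk => ?_⟩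
  obtain ⟨⟨⟨-, hest⟩, hlt⟩, hk₁, -⟩ := hϱ' k hk
  have hxs := hxk k hk₁
  have hys := hyk k (hϱ.trans hk₁)
  have hz := (hxs.solvesEq.sub hys.solvesEq).isSolution (B := Bk k)
  rw [map_sub, hxs.boundary, hys.boundary] at hz
  have h1 := hest _ _ _ hz ε (by rw [antideriv_sub]; exact (hfq k hk₁).1.le) (hfq k hk₁).2.le
  have h2 := norm_add_le (xk k - yk k) (yk k - y)
  rw [sub_add_sub_cancel] at h2
  linarith

end MultipointBVP

end

theorem mainTheorem3 {a b : ℝ} (hab : a < b) {r m : ℕ} (hr : 1 ≤ r) (hm : 1 ≤ m)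
    (A : MultipointBVP.Coeffs a b r m)
    (B : MultipointBVP.CVec hab (r - 1) m →L[ℂ] MultipointBVP.CNum (r * m))
    (hAB : MultipointBVP.UniquelySolvable A B) :
    -- the constant depends only on the differential expression and on the operator B
    (∃ κ : ℝ, 0 < κ ∧
      ∀ (Ak : ℕ → MultipointBVP.Coeffs a b r m)
        (Bk : ℕ → MultipointBVP.CVec hab (r - 1) m →L[ℂ] MultipointBVP.CNum (r * m))
        (ϱ₀ : ℕ), MultipointBVP.IsApproximating A B Ak Bk ϱ₀ →
      ∀ (ϱ₁ : ℕ), ϱ₀ ≤ ϱ₁ →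
      ∀ (σ : ℝ), IsLUB {c : ℝ | ∃ k, ϱ₁ ≤ k ∧ c = ‖Bk k‖} σ →
      ∀ (ε : ℝ), 0 < ε →
      ∀ (f : MultipointBVP.L1Vec a b m) (q : MultipointBVP.CNum (r * m))
        (y : MultipointBVP.CVec hab (r - 1) m), MultipointBVP.IsSolution A B f q y →
      -- the index does not depend on the right-hand sides of the approximating problems
      ∃ ϱ : ℕ, 0 < ϱ ∧ ϱ₁ ≤ ϱ ∧
        ∀ (fk : ℕ → MultipointBVP.L1Vec a b m) (qk : ℕ → MultipointBVP.CNum (r * m))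
          (xk : ℕ → MultipointBVP.CVec hab (r - 1) m),
        (∀ k, ϱ₁ ≤ k → MultipointBVP.IsSolution (Ak k) (Bk k) (fk k) (qk k) (xk k)) →
        (∀ k, ϱ₁ ≤ k →
          ‖MultipointBVP.antideriv hab (fk k) - MultipointBVP.antideriv hab f‖ < ε ∧
          ‖qk k - q‖ < ε) →
        ∀ k, ϱ ≤ k → ‖xk k - y‖ < κ * σ * ε) ∧
    (∀ (Ak : ℕ → MultipointBVP.Coeffs a b r m)
        (Bk : ℕ → MultipointBVP.CVec hab (r - 1) m →L[ℂ] MultipointBVP.CNum (r * m))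
        (ϱ₀ : ℕ), MultipointBVP.IsApproximating A B Ak Bk ϱ₀ →
      ∀ (ϱ₁ : ℕ), ϱ₀ ≤ ϱ₁ →
      BddAbove {c : ℝ | ∃ k, ϱ₁ ≤ k ∧ c = ‖Bk k‖} →
      ∀ (f : MultipointBVP.L1Vec a b m) (q : MultipointBVP.CNum (r * m))
        (y : MultipointBVP.CVec hab (r - 1) m), MultipointBVP.IsSolution A B f q y →
      ∀ (fk : ℕ → MultipointBVP.L1Vec a b m) (qk : ℕ → MultipointBVP.CNum (r * m))
        (xk : ℕ → MultipointBVP.CVec hab (r - 1) m),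
        (∀ k, ϱ₁ ≤ k → MultipointBVP.IsSolution (Ak k) (Bk k) (fk k) (qk k) (xk k)) →
        Tendsto (fun k => MultipointBVP.antideriv hab (fk k)) atTop
          (𝓝 (MultipointBVP.antideriv hab f)) →
        Tendsto qk atTop (𝓝 q) →
        Tendsto xk atTop (𝓝 y)) := by
  obtain ⟨κ, hκ, H⟩ := MultipointBVP.exists_const_norm_sub_lt hr hm hAB
  refine ⟨⟨κ, hκ, H⟩, fun Ak Bk ϱ₀ happ ϱ₁ hϱ hbdd f q y hy fk qk xk hxk hf hq => ?_⟩
  obtain ⟨S, hS⟩ := hbdd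
  have hS0 : 0 ≤ S := (norm_nonneg (Bk ϱ₁)).trans (hS ⟨ϱ₁, le_rfl, rfl⟩)
  rw [Metric.tendsto_atTop]
  intro δ hδ
  -- The first part is applied from the index `max ϱ₁ N` on, where the data are within this `ε`. As
  -- `κ` does not depend on the starting index or on `ε`, and the new supremum is at most `S`, the
  -- resulting bound is at most `δ`.
  have hε : 0 < δ / (κ * S + 1) := by positivity
  obtain ⟨N, hN⟩ := eventually_atTop.1 (((Metric.tendsto_nhds.1 hf) _ hε).and
    ((Metric.tendsto_nhds.1 hq) _ hε))
  have hsub : {c : ℝ | ∃ k, max ϱ₁ N ≤ k ∧ c = ‖Bk k‖} ⊆ {c : ℝ | ∃ k, ϱ₁ ≤ k ∧ c = ‖Bk k‖} :=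
    fun c ⟨k, hk, hc⟩ => ⟨k, (le_max_left _ _).trans hk, hc⟩
  have hlub := isLUB_csSup (s := {c : ℝ | ∃ k, max ϱ₁ N ≤ k ∧ c = ‖Bk k‖}) ⟨_, _, le_rfl, rfl⟩
    ⟨S, fun c hc => hS (hsub hc)⟩
  obtain ⟨ϱ, -, -, h⟩ := H Ak Bk ϱ₀ happ (max ϱ₁ N) (hϱ.trans (le_max_left _ _)) _ hlub _ hε f q y hy
  refine ⟨ϱ, fun k hk => ?_⟩
  rw [dist_eq_norm]
  refine (h fk qk xk (fun k hk => hxk k ((le_max_left _ _).trans hk)) (fun k hk => ?_) k hk).trans_le ?_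
  · have := hN k ((le_max_right _ _).trans hk)
    rwa [dist_eq_norm, dist_eq_norm] at this
  · have hle := hlub.2 fun c hc => hS (hsub hc)
    calc _ ≤ κ * S * (δ / (κ * S + 1)) := by gcongr
      _ ≤ (κ * S + 1) * (δ / (κ * S + 1)) := by gcongr; linarith
      _ = δ := mul_div_cancel₀ _ (by positivity)
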